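/- **Setting.** Let $n,r,q\in\mathbb N$, let matrices carry the Frobenius norm $\|\cdot\|_F$ and inner product ($\|\cdot\|$ is the spectral norm of a matrix, the operator norm of a linear map on matrices, and the Euclidean norm of a vector), and let $$\mathcal F_\lambda(X,Y)=\Psi(X)+\Phi(Y)+\tfrac12\|\mathcal A(XY^\top)-b\|^2+\tfrac\lambda2\|X-Y\|_F^2,\qquad X,Y\in\mathbb R^{n\times r},$$ where $\lambda\ge 0$, $b\in\mathbb R^q$, $\mathcal A:\mathbb R^{n\times n}\to\mathbb R^q$ is linear with $\mathcal A\mathcal A^*=\mathcal I_q$, and $\Psi,\Phi:\mathbb R^{n\times r}\to\mathbb R\cup\{+\infty\}$ are proper, lower semicontinuous and bounded from below. If $\lambda=0$, assume that $\mathcal F_0$ is level-bounded (all its sublevel sets are bounded). Let $\alpha,\beta\in\mathbb R\setminus\{0\}$ with $\frac1\alpha+\frac1\beta=1$, and put $H(X,Y,Z)=\frac\alpha2\|XY^\top-Z\|_F^2$. **Algorithm (A-NAUM).** Parameters: $\mu^{\min}>0$, $0<\sigma^{\min}<\sigma^{\max}<\infty$, $\tau>1$, $c>0$, $0<p_{\min}<1$,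 $\rho=\|\mathcal I-\frac{\beta}{\alpha+\beta}\mathcal A^*\mathcal A\|^2$, and $\gamma\ge0$ with $(\alpha+\gamma)\mathcal I+\beta\mathcal A^*\mathcal A\succeq0$. Start from $(X^0,Y^0)$ with $\mathcal F_\lambda(X^0,Y^0)<\infty$ and set $\mathcal R_0=\mathcal F_\lambda(X^0,Y^0)$. For $k=0,1,2,\dots$: 1. $Z^k=(\mathcal I-\frac{\beta}{\alpha+\beta}\mathcal A^*\mathcal A)(X^k(Y^k)^\top)+\frac{\beta}{\alpha+\beta}\mathcal A^*b$. 2. Choose $\mu\ge\mu^{\min}$ and $\sigma\in[\sigma^{\min},\sigma^{\max}]$ arbitrarily; let $\mu^{\max}=(\alpha+2\gamma\rho)\|Y^k\|^2+c$. - (a) Replace $\mu$ by $\min\{\mu,\mu^{\max}\}$ and compute $U$ by one of the $X$-updates below. - (b) Compute $V$ by one of the $Y$-updates below. - (c) If $\mathcal F_\lambda(U,V)-\mathcal R_k\le-\frac c2(\|U-X^k\|_F^2+\|V-Y^k\|_F^2)$, go to 3. - (d) If $\mu=\mu^{\max}$, replace $\sigma$ by $\min\{\tau\sigma,\ (\alpha+2\gamma\rho)\|U\|^2+c\}$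 and go to (b). Otherwise replace $(\mu,\sigma)$ by $(\tau\mu,\tau\sigma)$ and go to (a). 3. Set $(X^{k+1},Y^{k+1})=(U,V)$, choose $p_{k+1}\in[p_{\min},1]$, and set $\mathcal R_{k+1}=(1-p_{k+1})\mathcal R_k+p_{k+1}\mathcal F_\lambda(X^{k+1},Y^{k+1})$. $X$-updates: - proximal: $U\in\arg\min_X\ \Psi(X)+H(X,Y^k,Z^k)+\frac\lambda2\|X-Y^k\|_F^2+\frac\mu2\|X-X^k\|_F^2$; - prox-linear: the same with $H(X,Y^k,Z^k)$ replaced by $\langle\nabla_XH(X^k,Y^k,Z^k),X-X^k\rangle$; - hierarchical, available if $\Psi(X)=\sum_{i=1}^r\psi_i(x_i)$ in terms of the columns $x_i$ of $X$, with $\psi_i$ proper, lower semicontinuous and bounded from below: for $i=1,\dots,r$, the column $u_i$ of $U$ minimizes $x\mapsto\psi_i(x)+H\big([u_1,\dots,u_{i-1},x,x^k_{i+1},\dots,x^k_r],Y^k,Z^k\big)+\frac\lambda2\|x-y_i^k\|^2+\frac\mu2\|x-x_i^k\|^2$. The $Y$-updates are the analogous ones for $\Phi$, with $U$ in place of $X^k$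 and $\sigma$ in place of $\mu$: - proximal: $V\in\arg\min_Y\ \Phi(Y)+H(U,Y,Z^k)+\frac\lambda2\|U-Y\|_F^2+\frac\sigma2\|Y-Y^k\|_F^2$; - prox-linear: the same with $H(U,Y,Z^k)$ replaced by $\langle\nabla_YH(U,Y^k,Z^k),Y-Y^k\rangle$; - hierarchical, if $\Phi(Y)=\sum_{i=1}^r\phi_i(y_i)$ with $\phi_i$ proper, lower semicontinuous and bounded from below: $v_i$ minimizes $y\mapsto\phi_i(y)+H\big(U,[v_1,\dots,v_{i-1},y,y^k_{i+1},\dots,y^k_r],Z^k\big)+\frac\lambda2\|u_i-y\|^2+\frac\sigma2\|y-y_i^k\|^2$. The kind of update may be chosen anew each time. **KL exponent.** Assume that $\mathcal F_\lambda$ is a KL function with exponent $\theta\in[0,1)$: for each $\bar W$ with $\partial\mathcal F_\lambda(\bar W)\neq\emptyset$ ($\partial$ is the limiting subdifferential) there are $\tilde a>0$, $\nu\in(0,\infty]$ and a neighbourhood $\mathcal V$ of $\bar W$ such that $\varphi'\big(\mathcal F_\lambda(W)-\mathcal F_\lambda(\bar W)\big)\,\mathrm{dist}(0,\partial\mathcal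 F_\lambda(W))\ge1$ with $\varphi(t)=\tilde a\,t^{1-\theta}$ for all $W\in\mathcal V$ with $\mathcal F_\lambda(\bar W)<\mathcal F_\lambda(W)<\mathcal F_\lambda(\bar W)+\nu$. **Theorem.** Let $\{(X^k,Y^k)\}_{k\ge0}$ be an infinite sequence generated by the algorithm. If $\mathcal F_\lambda$ is level-bounded (which is assumed anyway when $\lambda=0$), then the sequence converges. Moreover, whenever the sequence converges, with limit $(\widetilde X,\widetilde Y)$ say: - (i) if $\theta\in[0,\frac12]$, there exist $d_1>0$ and $\varrho\in(0,1)$ such that $\|X^k-\widetilde X\|_F+\|Y^k-\widetilde Y\|_F\le d_1\varrho^k$ for all sufficiently large $k$; - (ii) if $\theta\in(\frac12,1)$, there exists $d_2>0$ such that $\|X^k-\widetilde X\|_F+\|Y^k-\widetilde Y\|_F\le d_2\,k^{-\frac{1-\theta}{2\theta-1}}$ for all sufficiently large $k$. -/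

import Mathlib

open Filter Topology

noncomputable section

/-! ### Variational analysis on a real inner product space

Functions with values in `ℝ ∪ {+∞}` are `EReal`-valued functions that never take the value `⊥`. -/

namespace Variational

variable {E : Type*} [NormedAddCommGroup E] [InnerProductSpace ℝ E]

/-- `h` is proper (never `-∞`, not identically `+∞`) and closed (lower semicontinuous). -/
structure IsProperClosed (h : E → EReal) : Prop where
  ne_bot : ∀ x, h x ≠ ⊥
  exists_ne_top : ∃ x, h x ≠ ⊤
  lsc : LowerSemicontinuous h

/-- `h` is bounded from below by a real number. -/
def IsBoundedBelow (h : E → EReal) : Prop :=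
  ∃ m : ℝ, ∀ x, (m : EReal) ≤ h x

/-- All sublevel sets at real levels are bounded. -/
def IsLevelBounded (h : E → EReal) : Prop :=
  ∀ t : ℝ, Bornology.IsBounded {x | h x ≤ (t : EReal)}

/-- `x` is a global minimizer of `f`. -/
def IsArgmin {F : Type*} (f : F → EReal) (x : F) : Prop :=
  ∀ y, f x ≤ f y

/-- The Fréchet subdifferential of `h` at `x` (empty outside the effective domain): all `D` with
`liminf_{y → x, y ≠ x} (h y - h x - ⟪D, y - x⟫) / ‖y - x‖ ≥ 0`, the inequality being written
without the quotient. -/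
def frechetSubdiff (h : E → EReal) (x : E) : Set E :=
  {D | h x ≠ ⊤ ∧ h x ≠ ⊥ ∧ ∀ ε : ℝ, 0 < ε →
    ∀ᶠ y in 𝓝 x, h x + ((inner ℝ D (y - x) - ε * ‖y - x‖ : ℝ) : EReal) ≤ h y}

/-- The limiting subdifferential of `h` at `x` (empty outside the effective domain). -/
def subdiff (h : E → EReal) (x : E) : Set E :=
  {D | h x ≠ ⊤ ∧ h x ≠ ⊥ ∧ ∃ (u : ℕ → E) (d : ℕ → E),
    Tendsto u atTop (𝓝 x) ∧ Tendsto (fun k => h (u k)) atTop (𝓝 (h x)) ∧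
    Tendsto d atTop (𝓝 D) ∧ ∀ k, d k ∈ frechetSubdiff h (u k)}

/-- The Kurdyka-Łojasiewicz inequality `φ'(h x - h x₀) * dist(0, ∂h(x)) ≥ 1` holds for all `x` in
some neighbourhood of `x₀` with `h x₀ < h x < h x₀ + ν`. The distance to the empty set is `+∞`. -/
def KLInequalityAt (h : E → EReal) (x₀ : E) (ν : EReal) (φ : ℝ → ℝ) : Prop :=
  ∃ V ∈ 𝓝 x₀, ∀ x ∈ V, h x₀ < h x → h x < h x₀ + ν →
    1 ≤ ENNReal.ofReal (deriv φ (h x - h x₀).toReal) * Metric.infEDist 0 (subdiff h x)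

/-- `h` is a KL function with exponent `θ`: at every point of the domain of `∂h` the KL property
holds with a desingularizing function `φ(t) = a * t ^ (1 - θ)`, `a > 0`, and some `ν ∈ (0, ∞]`;
`a`, `ν` and the neighbourhood may depend on the point. -/
def IsKLWithExponent (h : E → EReal) (θ : ℝ) : Prop :=
  ∀ x₀, (subdiff h x₀).Nonempty → ∃ (ν : EReal) (a : ℝ), 0 < ν ∧ 0 < a ∧
    KLInequalityAt h x₀ ν (fun t => a * t ^ (1 - θ))

end Variational

/-! ### Real matrices with the Frobenius inner product -/

/-- Column vectors with the Euclidean norm. -/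
abbrev RVec (n : ℕ) := EuclideanSpace ℝ (Fin n)

/-- Real `m × n` matrices; the norm and inner product are those of Frobenius. -/
abbrev RMat (m n : ℕ) := EuclideanSpace ℝ (Fin m × Fin n)

namespace RMat

/-- The underlying matrix. -/
def toM {m n : ℕ} (X : RMat m n) : Matrix (Fin m) (Fin n) ℝ :=
  Matrix.of fun i j => X (i, j)

/-- A matrix as an element of the Frobenius space. -/
def ofM {m n : ℕ} (M : Matrix (Fin m) (Fin n) ℝ) : RMat m n :=
  WithLp.toLp 2 fun p => M p.1 p.2

/-- The product `X Yᵀ`. -/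
def mulT {m n r : ℕ} (X : RMat m r) (Y : RMat n r) : RMat m n :=
  ofM (toM X * (toM Y).transpose)

/-- The `j`-th column. -/
def col {m n : ℕ} (X : RMat m n) (j : Fin n) : RVec m :=
  WithLp.toLp 2 fun i => X (i, j)

/-- The spectral norm: the operator norm between Euclidean spaces. -/
def specNorm {m n : ℕ} (X : RMat m n) : ℝ :=
  ‖LinearMap.toContinuousLinearMap (Matrix.toEuclideanLin (toM X))‖

/-- The matrix whose columns with index `< i` are those of `U`, whose `i`-th column is `v`, and
whose columns with index `> i` are those of `X`. -/
def hybrid {m n : ℕ} (U X : RMat m n) (i : Fin n) (v : RVec m) : RMat m n :=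
  ofM (Matrix.of fun a j => if j < i then U (a, j) else if j = i then v a else X (a, j))

end RMat

open RMat Variational

/-- The data of a generalized symmetric matrix factorization problem. -/
structure GSMF (n r q : ℕ) where
  Ψ : RMat n r → EReal
  Φ : RMat n r → EReal
  A : RMat n n →L[ℝ] RVec q
  b : RVec q
  lam : ℝ

namespace GSMF

variable {n r q : ℕ}

/-- The objective `Ψ(X) + Φ(Y) + ½‖A(XYᵀ) - b‖² + (λ/2)‖X - Y‖²`. -/
def objective (P : GSMF n r q) (X Y : RMat n r) : EReal :=
  P.Ψ X + P.Φ Y +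
    ((1 / 2 * ‖P.A (mulT X Y) - P.b‖ ^ 2 + P.lam / 2 * ‖X - Y‖ ^ 2 : ℝ) : EReal)

/-- The objective as a function of the pair `(X, Y)`, on the product with the inner product
`⟪X, X'⟫ + ⟪Y, Y'⟫`. -/
def objectivePair (P : GSMF n r q) (W : WithLp 2 (RMat n r × RMat n r)) : EReal :=
  P.objective W.fst W.snd

/-- Standing assumptions on the problem and on the relaxation parameters `α, β`. -/
structure Assumption (P : GSMF n r q) (α β : ℝ) : Prop where
  Ψ_proper : IsProperClosed P.Ψ
  Ψ_bdd : IsBoundedBelow P.Ψ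
  Φ_proper : IsProperClosed P.Φ
  Φ_bdd : IsBoundedBelow P.Φ
  coisometry : P.A ∘L ContinuousLinearMap.adjoint P.A = ContinuousLinearMap.id ℝ (RVec q)
  α_ne : α ≠ 0
  β_ne : β ≠ 0
  inv_add_inv : 1 / α + 1 / β = 1
  lam_nonneg : 0 ≤ P.lam
  levelBounded : P.lam = 0 → IsLevelBounded P.objectivePair

/-- The parameters of the algorithm. -/
structure Params where
  (α β γ μmin σmin σmax τ c pmin : ℝ)

/-- `H_α(X, Y, Z) = (α/2)‖XYᵀ - Z‖²`. -/
def H (α : ℝ) (X Y : RMat n r) (Z : RMat n n) : ℝ :=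
  α / 2 * ‖mulT X Y - Z‖ ^ 2

/-- The gradient `α (XYᵀ - Z) Y` of `H_α` in `X`. -/
def gradXH (α : ℝ) (X Y : RMat n r) (Z : RMat n n) : RMat n r :=
  α • ofM (toM (mulT X Y - Z) * toM Y)

/-- The gradient `α (XYᵀ - Z)ᵀ X` of `H_α` in `Y`. -/
def gradYH (α : ℝ) (X Y : RMat n r) (Z : RMat n n) : RMat n r :=
  α • ofM ((toM (mulT X Y - Z)).transpose * toM X)

/-- `ψ` is a splitting of `Ψ` into proper closed functions of the columns, bounded from below. -/
structure IsColumnSplitting (Ψ : RMat n r → EReal) (ψ : Fin r → RVec n → EReal) : Prop where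
  sum_eq : ∀ X, Ψ X = ∑ i, ψ i (col X i)
  proper : ∀ i, IsProperClosed (ψ i)
  bdd : ∀ i, IsBoundedBelow (ψ i)

/-- `ρ = ‖I - (β/(α+β)) A*A‖²`. -/
def rho (P : GSMF n r q) (S : Params) : ℝ :=
  ‖ContinuousLinearMap.id ℝ (RMat n n) -
    (S.β / (S.α + S.β)) • (ContinuousLinearMap.adjoint P.A ∘L P.A)‖ ^ 2

/-- The admissible parameters: the constraints that the algorithm puts on its inputs. The relation
between `α` and `β` is part of `Assumption`. -/
structure Params.Admissible (S : Params) (P : GSMF n r q) : Prop where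
  μmin_pos : 0 < S.μmin
  σmin_pos : 0 < S.σmin
  σmin_lt : S.σmin < S.σmax
  τ_gt : 1 < S.τ
  c_pos : 0 < S.c
  pmin_pos : 0 < S.pmin
  pmin_lt : S.pmin < 1
  γ_nonneg : 0 ≤ S.γ
  γ_psd : ((S.α + S.γ) • ContinuousLinearMap.id ℝ (RMat n n) +
    S.β • (ContinuousLinearMap.adjoint P.A ∘L P.A)).IsPositive

/-- `Z = (I - (β/(α+β)) A*A)(XYᵀ) + (β/(α+β)) A*(b)`. -/
def zUpdate (P : GSMF n r q) (S : Params) (X Y : RMat n r) : RMat n n :=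
  mulT X Y - (S.β / (S.α + S.β)) • ContinuousLinearMap.adjoint P.A (P.A (mulT X Y)) +
    (S.β / (S.α + S.β)) • ContinuousLinearMap.adjoint P.A P.b

/-- `U` is a candidate for the new `X`, computed from the current `(X, Y, Z)` with proximal
parameter `μ` by a proximal, a prox-linear, or (when `Ψ` splits into columns) a hierarchical-prox
update. -/
def XUpdate (P : GSMF n r q) (α : ℝ) (X Y : RMat n r) (Z : RMat n n) (μ : ℝ)
    (U : RMat n r) : Prop :=
  IsArgmin (fun X' => P.Ψ X' +
    ((H α X' Y Z + P.lam / 2 * ‖X' - Y‖ ^ 2 + μ / 2 * ‖X' - X‖ ^ 2 : ℝ) : EReal)) U ∨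
  IsArgmin (fun X' => P.Ψ X' +
    ((inner ℝ (gradXH α X Y Z) (X' - X) + P.lam / 2 * ‖X' - Y‖ ^ 2 +
      μ / 2 * ‖X' - X‖ ^ 2 : ℝ) : EReal)) U ∨
  ∃ ψ : Fin r → RVec n → EReal, IsColumnSplitting P.Ψ ψ ∧ ∀ i : Fin r,
    IsArgmin (fun v => ψ i v +
      ((H α (hybrid U X i v) Y Z + P.lam / 2 * ‖v - col Y i‖ ^ 2 +
        μ / 2 * ‖v - col X i‖ ^ 2 : ℝ) : EReal)) (col U i)

/-- `V` is a candidate for the new `Y`, computed from the current `(Y, Z)` and from the candidate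
`U` with proximal parameter `σ` by one of the same three kinds of update. -/
def YUpdate (P : GSMF n r q) (α : ℝ) (U Y : RMat n r) (Z : RMat n n) (σ : ℝ)
    (V : RMat n r) : Prop :=
  IsArgmin (fun Y' => P.Φ Y' +
    ((H α U Y' Z + P.lam / 2 * ‖U - Y'‖ ^ 2 + σ / 2 * ‖Y' - Y‖ ^ 2 : ℝ) : EReal)) V ∨
  IsArgmin (fun Y' => P.Φ Y' +
    ((inner ℝ (gradYH α U Y Z) (Y' - Y) + P.lam / 2 * ‖U - Y'‖ ^ 2 +
      σ / 2 * ‖Y' - Y‖ ^ 2 : ℝ) : EReal)) V ∨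
  ∃ φ : Fin r → RVec n → EReal, IsColumnSplitting P.Φ φ ∧ ∀ i : Fin r,
    IsArgmin (fun v => φ i v +
      ((H α U (hybrid V Y i v) Z + P.lam / 2 * ‖col U i - v‖ ^ 2 +
        σ / 2 * ‖v - col Y i‖ ^ 2 : ℝ) : EReal)) (col V i)

/-- The line search criterion `F(U, V) - R ≤ -(c/2)(‖U - X‖² + ‖V - Y‖²)`. -/
def Accepts (P : GSMF n r q) (S : Params) (X Y : RMat n r) (R : ℝ) (U V : RMat n r) : Prop :=
  P.objective U V ≤ ((R - S.c / 2 * (‖U - X‖ ^ 2 + ‖V - Y‖ ^ 2) : ℝ) : EReal)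

/-- `μ^max = (α + 2γρ)‖Y‖² + c`, with the spectral norm; the same formula at `U` gives `σ^max`. -/
def cap (P : GSMF n r q) (S : Params) (Y : RMat n r) : ℝ :=
  (S.α + 2 * S.γ * P.rho S) * specNorm Y ^ 2 + S.c

/-- The states `(μ, σ, U, V)` that the inner loop can reach at the line search test, at the outer
iterate `(X, Y)` with reference value `R`, when it starts from the proximal parameters `μ₀, σ₀`. -/
inductive InnerReach (P : GSMF n r q) (S : Params) (X Y : RMat n r) (R μ₀ σ₀ : ℝ) :
    ℝ → ℝ → RMat n r → RMat n r → Prop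
  /-- First pass. -/
  | start (U V : RMat n r)
      (hU : P.XUpdate S.α X Y (P.zUpdate S X Y) (min μ₀ (P.cap S Y)) U)
      (hV : P.YUpdate S.α U Y (P.zUpdate S X Y) σ₀ V) :
      InnerReach P S X Y R μ₀ σ₀ (min μ₀ (P.cap S Y)) σ₀ U V
  /-- The test failed and `μ` is not yet at its cap: increase both parameters, recompute both
  candidates. -/
  | raiseBoth (μ σ : ℝ) (U V U' V' : RMat n r)
      (hprev : InnerReach P S X Y R μ₀ σ₀ μ σ U V)
      (hfail : ¬ P.Accepts S X Y R U V) (hμ : μ ≠ P.cap S Y)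
      (hU : P.XUpdate S.α X Y (P.zUpdate S X Y) (min (S.τ * μ) (P.cap S Y)) U')
      (hV : P.YUpdate S.α U' Y (P.zUpdate S X Y) (S.τ * σ) V') :
      InnerReach P S X Y R μ₀ σ₀ (min (S.τ * μ) (P.cap S Y)) (S.τ * σ) U' V'
  /-- The test failed and `μ` is at its cap: keep `μ` and `U`, increase `σ` up to its cap, and
  recompute `V`. -/
  | raiseSigma (μ σ : ℝ) (U V V' : RMat n r)
      (hprev : InnerReach P S X Y R μ₀ σ₀ μ σ U V)
      (hfail : ¬ P.Accepts S X Y R U V) (hμ : μ = P.cap S Y)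
      (hV : P.YUpdate S.α U Y (P.zUpdate S X Y) (min (S.τ * σ) (P.cap S U)) V') :
      InnerReach P S X Y R μ₀ σ₀ μ (min (S.τ * σ) (P.cap S U)) U V'

/-- `(X k, Y k)` is an infinite sequence of iterates generated by the average-type nonmonotone
alternating updating method, with reference values `R k`. The starting point is in the effective
domain of the objective. -/
structure IsRun (P : GSMF n r q) (S : Params) (X Y : ℕ → RMat n r) (R : ℕ → ℝ) : Prop where
  init_dom : P.objective (X 0) (Y 0) ≠ ⊤
  init_ref : R 0 = (P.objective (X 0) (Y 0)).toReal
  step : ∀ k, ∃ μ₀ σ₀ μ σ : ℝ, S.μmin ≤ μ₀ ∧ S.σmin ≤ σ₀ ∧ σ₀ ≤ S.σmax ∧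
    InnerReach P S (X k) (Y k) (R k) μ₀ σ₀ μ σ (X (k + 1)) (Y (k + 1)) ∧
    P.Accepts S (X k) (Y k) (R k) (X (k + 1)) (Y (k + 1))
  ref : ∀ k, ∃ p : ℝ, S.pmin ≤ p ∧ p ≤ 1 ∧
    R (k + 1) = (1 - p) * R k + p * (P.objective (X (k + 1)) (Y (k + 1))).toReal

end GSMF

end

/-! Write `W k = (X k, Y k)`, `v k` for its objective value, `Δ k = ‖W (k+1) - W k‖`. The values `v
k` need not decrease, but the references `R k` do: `R k - R (k+1) = p (R k - v (k+1))` with `p ≥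
pmin`, and the line search gives `R k - v (k+1) ≥ (c/2) Δ k ^ 2`. Hence `R` decreases to a limit
`l`, `v` has the same limit, and `Δ k → 0`.

Put `r k = R k - l`. The KL inequality is used at the new point `W (k+1)`, where some subgradient
has norm at most `C Δ k`. Either `v (k+1) - l < r k / 2`, and averaging makes `r` drop by a fixed
fraction, or `v (k+1) - l ≥ r k / 2`, and KL bounds `r k ^ θ` by a multiple of `Δ k`. After raising
`θ` to at least `1/2`, both cases give `r k ^ (2θ) ≤ K (r k - r (k+1))`
(`rpow_le_mul_sub_of_averaged`). Multiplied by `Δ k ^ 2 ≤ K (r k - r (k+1))`, this yields `Δ k ≤ φ k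
- φ (k+1)` with `φ` a multiple of `r ^ (1 - θ)` (`le_mul_rpow_sub_rpow`). Telescoping gives
convergence and `dist (W k) w ≤ φ k`; the rates are those of the scalar recursion for `r`.

The subgradient bound rests on three facts. Every update is a minimization, so it leaves a global
quadratic minorant of the nonsmooth term whose slope is nearly minus a partial gradient
(`XUpdate.exists_hasQuadraticSupport`). The choice of `Z` makes the partial gradients of `H` those
of the data term (`smul_mulT_sub_zUpdate`). The inner loop keeps `μ` and `σ` bounded on bounded sets
(`InnerReach.bounds`), so all constants are uniform. Uniform minorants also force objective values
to converge at cluster points, whence a cluster point has value `l` and is critical, so KL is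
available there (`zero_mem_subdiff_of_mapClusterPt`). -/

open RMat Variational

noncomputable section

/-! ### Sequences under a Kurdyka-Łojasiewicz type recursion -/

/-- Tangent inequality for the concave function `t ↦ t ^ s`. -/
theorem mul_rpow_mul_sub_le_rpow_sub_rpow {r r' s : ℝ} (hr : 0 < r) (hr' : 0 ≤ r')
    (hs0 : 0 ≤ s) (hs1 : s ≤ 1) : s * r ^ (s - 1) * (r - r') ≤ r ^ s - r' ^ s := by
  have ht : -1 ≤ (r' - r) / r := by
    rw [le_div_iff₀ hr]; linarith
  have h1 : r' = r * (1 + (r' - r) / r) := by field_simp; ring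
  have h2 := rpow_one_add_le_one_add_mul_self ht hs0 hs1
  have h3 : r' ^ s = r ^ s * (1 + (r' - r) / r) ^ s := by
    conv_lhs => rw [h1]
    exact Real.mul_rpow hr.le (by linarith)
  have h4 : r ^ s * (1 + s * ((r' - r) / r)) = r ^ s - s * r ^ (s - 1) * (r - r') := by
    rw [Real.rpow_sub_one hr.ne']; field_simp; ring
  have h5 := mul_le_mul_of_nonneg_left h2 (Real.rpow_nonneg hr.le s)
  linarith

/-- Averaging gives `r - r' = p (r - f)`, so the reference realizes at least the fraction `pm` of
the gap `r - f ≥ 0`. -/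
theorem averaged_decrease {c pm p r r' f Δ : ℝ} (hc : 0 < c) (hpm : 0 < pm) (hp : pm ≤ p)
    (hr' : r' = (1 - p) * r + p * f) (hf : f ≤ r - c / 2 * Δ ^ 2) :
    r - f ≤ (r - r') / pm ∧ Δ ^ 2 ≤ 2 / (c * pm) * (r - r') := by
  have h0 : 0 ≤ c / 2 * Δ ^ 2 := by positivity
  have h1 : r - f ≤ (r - r') / pm := by
    rw [le_div_iff₀ hpm]; nlinarith
  refine ⟨h1, ?_⟩
  have h2 : c / 2 * Δ ^ 2 ≤ (r - r') / pm := by linarith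
  have h3 : Δ ^ 2 = 2 / c * (c / 2 * Δ ^ 2) := by field_simp
  rw [h3]
  calc 2 / c * (c / 2 * Δ ^ 2) ≤ 2 / c * ((r - r') / pm) :=
        mul_le_mul_of_nonneg_left h2 (by positivity)
    _ = 2 / (c * pm) * (r - r') := by field_simp

/-- Dichotomy on whether the gap `r - f` is at least about half of `r`. If so, `r ^ (2θ) ≤ r` is
controlled by the decrease directly; otherwise `f ≥ r / 2 > 0` and KL applies. The objective may
fall below its limit, so KL is required only for `0 < f`. The constant 8 is the loss `2 ^ (2θ) ≤ 4`
times the 2 of `averaged_decrease`. -/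
theorem rpow_le_mul_sub_of_averaged {θ c pm C p r r' f Δ : ℝ} (hθ : 1 / 2 ≤ θ) (hθ1 : θ < 1)
    (hc : 0 < c) (hpm : 0 < pm) (hp : pm ≤ p) (hr0 : 0 ≤ r) (hr1 : r ≤ 1)
    (hr' : r' = (1 - p) * r + p * f)
    (hf : f ≤ r - c / 2 * Δ ^ 2) (hKL : 0 < f → f ^ θ ≤ C * Δ) :
    r ^ (2 * θ) ≤ (8 * C ^ 2 / (c * pm) + 2 / pm) * (r - r') := by
  obtain ⟨h1, h2⟩ := averaged_decrease hc hpm hp hr' hf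
  have hδ : 0 ≤ r - r' := by
    have h3 : 0 ≤ 2 / (c * pm) * (r - r') := (sq_nonneg _).trans h2
    exact nonneg_of_mul_nonneg_right h3 (by positivity)
  have hle : r ^ (2 * θ) ≤ r := by
    calc r ^ (2 * θ) ≤ r ^ (1 : ℝ) := Real.rpow_le_rpow_of_exponent_ge' hr0 hr1 zero_le_one
          (by linarith)
      _ = r := Real.rpow_one r
  have hA : 0 ≤ 8 * C ^ 2 / (c * pm) * (r - r') := by positivity
  have hB : 0 ≤ 2 / pm * (r - r') := by positivity
  rw [add_mul]
  rcases le_or_gt (r / 2) ((r - r') / pm) with h | h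
  · have : 2 / pm * (r - r') = 2 * ((r - r') / pm) := by ring
    linarith
  · have hf2 : r / 2 ≤ f := by linarith
    have hr2 : 0 < r := by
      have : 0 ≤ (r - r') / pm := by positivity
      linarith
    have hfp : 0 < f := by linarith
    have h3 := hKL hfp
    have h4 : (f ^ θ) ^ 2 ≤ (C * Δ) ^ 2 := pow_le_pow_left₀ (Real.rpow_nonneg hfp.le _) h3 2
    have h5 : (f ^ θ) ^ 2 = f ^ (2 * θ) := by
      rw [mul_comm, Real.rpow_mul hfp.le]; norm_cast
    have h6 : (r / 2) ^ (2 * θ) ≤ f ^ (2 * θ) :=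
      Real.rpow_le_rpow (by positivity) hf2 (by linarith)
    have h7 : (r / 2) ^ (2 * θ) = r ^ (2 * θ) / 2 ^ (2 * θ) := Real.div_rpow hr0 (by norm_num) _
    have h8 : (2 : ℝ) ^ (2 * θ) ≤ 4 := by
      calc (2 : ℝ) ^ (2 * θ) ≤ 2 ^ (2 : ℝ) :=
            Real.rpow_le_rpow_of_exponent_le (by norm_num) (by linarith)
        _ = 4 := by norm_num
    have h9 : (0 : ℝ) < 2 ^ (2 * θ) := by positivity
    have h10 : r ^ (2 * θ) ≤ 4 * (C * Δ) ^ 2 := by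
      have h11 : r ^ (2 * θ) / 2 ^ (2 * θ) ≤ (C * Δ) ^ 2 := by linarith
      rw [div_le_iff₀ h9] at h11
      nlinarith [sq_nonneg (C * Δ)]
    have h12 : 4 * (C * Δ) ^ 2 ≤ 8 * C ^ 2 / (c * pm) * (r - r') := by
      calc 4 * (C * Δ) ^ 2 = 4 * C ^ 2 * Δ ^ 2 := by ring
        _ ≤ 4 * C ^ 2 * (2 / (c * pm) * (r - r')) :=
            mul_le_mul_of_nonneg_left h2 (by positivity)
        _ = _ := by ring
    linarith

/-- The product of the two hypotheses is `(r ^ θ * Δ) ^ 2 ≤ (K (r - r')) ^ 2`; after dividing by `r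
^ θ`, concavity of `t ^ (1 - θ)` makes the bound telescoping. -/
theorem le_mul_rpow_sub_rpow {θ K r r' Δ : ℝ} (hθ1 : θ < 1) (hθ0 : 0 ≤ θ)
    (hK : 0 < K) (hr' : 0 ≤ r') (hrr : r' ≤ r)
    (h1 : r ^ (2 * θ) ≤ K * (r - r')) (h2 : Δ ^ 2 ≤ K * (r - r')) :
    Δ ≤ K / (1 - θ) * (r ^ (1 - θ) - r' ^ (1 - θ)) := by
  rcases (hr'.trans hrr).eq_or_lt with h | h
  · have h3 : r' = 0 := by linarith
    subst h3
    rw [← h] at h2 ⊢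
    have : Δ = 0 := by nlinarith
    simp [this]
  · have hpos : 0 < r ^ θ := Real.rpow_pos_of_pos h θ
    have h5 : (r ^ θ) ^ 2 = r ^ (2 * θ) := by
      rw [mul_comm, Real.rpow_mul h.le]; norm_cast
    have hδ : 0 ≤ r - r' := by linarith
    have h6 : (r ^ θ * Δ) ^ 2 ≤ (K * (r - r')) ^ 2 := by
      rw [mul_pow, h5, sq (K * (r - r'))]
      exact mul_le_mul h1 h2 (sq_nonneg _) (by positivity)
    have h7 : r ^ θ * Δ ≤ K * (r - r') := le_of_sq_le_sq h6 (by positivity)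
    have h8 := mul_rpow_mul_sub_le_rpow_sub_rpow (s := 1 - θ) h hr' (by linarith) (by linarith)
    have h9 : r ^ (1 - θ - 1) = (r ^ θ)⁻¹ := by
      rw [← Real.rpow_neg h.le]; congr 1; ring
    rw [h9] at h8
    have h10 : (0 : ℝ) < 1 - θ := by linarith
    calc Δ ≤ K * (r - r') / r ^ θ := by rw [le_div_iff₀ hpos]; linarith
      _ = K / (1 - θ) * ((1 - θ) * (r ^ θ)⁻¹ * (r - r')) := by field_simp
      _ ≤ _ := mul_le_mul_of_nonneg_left h8 (by positivity)

/-- A sequence whose steps near a cluster point are dominated by the decrease of a null sequence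
converges to that cluster point. -/
theorem tendsto_of_mapClusterPt_of_dist_le {E : Type*} [PseudoMetricSpace E] {W : ℕ → E} {w : E}
    {φ : ℕ → ℝ} {η : ℝ} (hη : 0 < η) (hφ0 : ∀ k, 0 ≤ φ k) (hφ : Tendsto φ atTop (𝓝 0))
    (hΔ : Tendsto (fun k => dist (W k) (W (k + 1))) atTop (𝓝 0))
    (hstep : ∀ᶠ k in atTop, dist (W (k + 1)) w < η →
      dist (W k) (W (k + 1)) ≤ φ k - φ (k + 1))
    (hcl : MapClusterPt w atTop W) : Tendsto W atTop (𝓝 w) := by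
  rw [Metric.tendsto_atTop]
  intro ε hε
  set e := min ε η with he
  have hepos : 0 < e := lt_min hε hη
  have hev : ∀ᶠ k in atTop, ∀ j ≥ k, φ j < e / 4 ∧ dist (W j) (W (j + 1)) < e / 4 ∧
      (dist (W (j + 1)) w < η → dist (W j) (W (j + 1)) ≤ φ j - φ (j + 1)) := by
    have h := ((hφ.eventually_lt_const (by positivity : 0 < e / 4)).and
      ((hΔ.eventually_lt_const (by positivity : 0 < e / 4)).and hstep))
    exact eventually_forall_ge_atTop.mpr h
  have hfr : ∃ᶠ k in atTop, dist (W k) w < e / 4 :=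
    hcl.frequently (Metric.ball_mem_nhds w (by positivity))
  obtain ⟨k, hk, hall⟩ := (hfr.and_eventually hev).exists
  have key : ∀ j ≥ k, dist (W j) w ≤ dist (W k) w + (φ k - φ j) := by
    intro j hj
    induction j, hj using Nat.le_induction with
    | base => simp
    | succ j hj ih =>
      obtain ⟨h1, h2, h3⟩ := hall j hj
      have h4 := (hall k le_rfl).1
      have h5 := dist_triangle_left (W (j + 1)) w (W j)
      -- The step bound requires the next point to be near `w`: the induction hypothesis gives `dist
      -- (W j) w < e / 2`, and the step adds less than `e / 4`.
      have h6 := h3 (by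
        have := hφ0 j
        have := min_le_right ε η
        linarith)
      linarith
  refine ⟨k, fun j hj => ?_⟩
  have h1 := key j hj
  have h2 := (hall k le_rfl).1
  have h3 := hφ0 j
  have h4 := min_le_left ε η
  linarith

theorem eventually_dist_le_of_tendsto {E : Type*} [PseudoMetricSpace E] {W : ℕ → E} {w : E}
    {φ : ℕ → ℝ} (hφ0 : ∀ k, 0 ≤ φ k) (hW : Tendsto W atTop (𝓝 w))
    (hstep : ∀ᶠ k in atTop, dist (W k) (W (k + 1)) ≤ φ k - φ (k + 1)) :
    ∀ᶠ k in atTop, dist (W k) w ≤ φ k := by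
  obtain ⟨N, hN⟩ := eventually_atTop.mp hstep
  filter_upwards [eventually_ge_atTop N] with k hk
  have key : ∀ j ≥ k, dist (W k) (W j) ≤ φ k - φ j := by
    intro j hj
    induction j, hj using Nat.le_induction with
    | base => simp
    | succ j hj ih =>
      have h5 := dist_triangle (W k) (W j) (W (j + 1))
      have h6 := hN j (hk.trans hj)
      linarith
  refine le_of_tendsto (tendsto_const_nhds.dist hW) ?_
  filter_upwards [eventually_ge_atTop k] with j hj
  linarith [key j hj, hφ0 j]

/-- Linear decay from `r k ≤ K (r k - r (k + 1))`. -/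
theorem exists_geometric_bound {r : ℕ → ℝ} {K : ℝ} (hr : ∀ k, 0 ≤ r k) (hK : 0 < K)
    (h : ∀ᶠ k in atTop, r k ≤ K * (r k - r (k + 1))) :
    ∃ d ϱ : ℝ, 0 < d ∧ 0 < ϱ ∧ ϱ < 1 ∧ ∀ᶠ k in atTop, r k ≤ d * ϱ ^ k := by
  obtain ⟨N, hN⟩ := eventually_atTop.mp h
  -- The lower bound 2 keeps the ratio `1 - 1 / L` positive.
  set L := max K 2 with hL
  have hL2 : 2 ≤ L := le_max_right _ _
  have hLp : 0 < L := by linarith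
  set ϱ := 1 - 1 / L with hϱ
  have h1L : 1 / L ≤ 1 / 2 := one_div_le_one_div_of_le (by norm_num) hL2
  have h1L' : 0 < 1 / L := by positivity
  have hϱ0 : 0 < ϱ := by linarith
  have hdec : ∀ k ≥ N, r (k + 1) ≤ ϱ * r k := by
    intro k hk
    have h1 := hN k hk
    have h2 : 0 ≤ r k - r (k + 1) := nonneg_of_mul_nonneg_right ((hr k).trans h1) hK
    have h3 : r k ≤ L * (r k - r (k + 1)) :=
      h1.trans (mul_le_mul_of_nonneg_right (le_max_left _ _) h2)
    have h4 : r k / L ≤ r k - r (k + 1) := by rw [div_le_iff₀ hLp]; linarith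
    have h5 : ϱ * r k = r k - r k / L := by rw [hϱ]; ring
    linarith
  have hind : ∀ k ≥ N, r k ≤ r N / ϱ ^ N * ϱ ^ k := by
    intro k hk
    induction k, hk using Nat.le_induction with
    | base => field_simp; exact le_rfl
    | succ k hk ih =>
      calc r (k + 1) ≤ ϱ * r k := hdec k hk
        _ ≤ ϱ * (r N / ϱ ^ N * ϱ ^ k) := mul_le_mul_of_nonneg_left ih hϱ0.le
        _ = _ := by ring
  refine ⟨r N / ϱ ^ N + 1, ϱ, ?_, hϱ0, by linarith, ?_⟩
  · have := hr N; positivity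
  · filter_upwards [eventually_ge_atTop N] with k hk
    have : 0 < ϱ ^ k := by positivity
    linarith [hind k hk, add_mul (r N / ϱ ^ N) 1 (ϱ ^ k)]

/-- Sublinear decay from `r k ^ (s + 1) ≤ K (r k - r (k + 1))`. -/
theorem exists_power_bound {r : ℕ → ℝ} {K s : ℝ} (hr : ∀ k, 0 ≤ r k) (hs : 0 < s) (hK : 0 < K)
    (h : ∀ᶠ k in atTop, r k ^ (s + 1) ≤ K * (r k - r (k + 1))) :
    ∃ d : ℝ, 0 < d ∧ ∀ᶠ k : ℕ in atTop, r k ≤ d * (k : ℝ) ^ (-(1 / s)) := by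
  obtain ⟨N, hN⟩ := eventually_atTop.mp h
  have hmono : ∀ k ≥ N, r (k + 1) ≤ r k := by
    intro k hk
    have h1 := hN k hk
    have h2 : 0 ≤ r k ^ (s + 1) := Real.rpow_nonneg (hr k) _
    have h3 : 0 ≤ r k - r (k + 1) := nonneg_of_mul_nonneg_right (h2.trans h1) hK
    linarith
  -- Discrete form of integrating `r' ≤ -r ^ (s + 1) / K`: the quantity `r ^ (-s)` grows by at least
  -- `s / K` per step, by `log x ≤ x - 1` and `1 + y ≤ exp y`.
  have hinv : ∀ k ≥ N, 0 < r (k + 1) → r k ^ (-s) + s / K ≤ r (k + 1) ^ (-s) := by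
    intro k hk hpos
    have hk0 : 0 < r k := hpos.trans_le (hmono k hk)
    have h1 := hN k hk
    have hq : 0 < r (k + 1) / r k := by positivity
    have hlog : Real.log (r (k + 1) / r k) ≤ r (k + 1) / r k - 1 := Real.log_le_sub_one_of_pos hq
    have h2 : r (k + 1) / r k - 1 ≤ - (r k ^ s / K) := by
      have h3 : r k ^ (s + 1) = r k ^ s * r k := Real.rpow_add_one hk0.ne' s
      rw [h3] at h1
      have h4 : r k ^ s / K ≤ (r k - r (k + 1)) / r k := by
        rw [div_le_div_iff₀ hK hk0]; linarith
      have h5 : (r k - r (k + 1)) / r k = 1 - r (k + 1) / r k := by field_simp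
      linarith
    have h6 : 1 + s * (r k ^ s / K) ≤ (r (k + 1) / r k) ^ (-s) := by
      rw [Real.rpow_def_of_pos hq]
      calc 1 + s * (r k ^ s / K) ≤ Real.log (r (k + 1) / r k) * -s + 1 := by nlinarith
        _ ≤ _ := Real.add_one_le_exp _
    have h7 : (r (k + 1) / r k) ^ (-s) = r (k + 1) ^ (-s) / r k ^ (-s) :=
      Real.div_rpow hpos.le hk0.le _
    have h8 : 0 < r k ^ (-s) := Real.rpow_pos_of_pos hk0 _
    rw [h7, le_div_iff₀ h8] at h6
    have h9 : r k ^ s * r k ^ (-s) = 1 := by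
      rw [← Real.rpow_add hk0]; simp
    calc r k ^ (-s) + s / K = r k ^ (-s) + s / K * (r k ^ s * r k ^ (-s)) := by rw [h9, mul_one]
      _ = (1 + s * (r k ^ s / K)) * r k ^ (-s) := by ring
      _ ≤ _ := h6
  have hind : ∀ k ≥ N, 0 < r k → s / K * ((k : ℝ) - N) ≤ r k ^ (-s) := by
    intro k hk
    induction k, hk using Nat.le_induction with
    | base => intro h; simp [Real.rpow_nonneg h.le]
    | succ k hk ih =>
      intro hpos
      have h1 := ih (hpos.trans_le (hmono k hk))
      have h2 := hinv k hk hpos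
      push_cast
      calc s / K * ((k : ℝ) + 1 - N) = s / K * ((k : ℝ) - N) + s / K := by ring
        _ ≤ _ := by linarith
  have hsK : 0 < s / (2 * K) := by positivity
  refine ⟨(s / (2 * K)) ^ (-(1 / s)), Real.rpow_pos_of_pos hsK _, ?_⟩
  -- Beyond `2 N` one has `k - N ≥ k / 2`, whence the 2 in `s / (2 * K)`.
  filter_upwards [eventually_ge_atTop (2 * N + 1)] with k hk
  have hkp : (0 : ℝ) < k := by exact_mod_cast (by omega : 0 < k)
  have hk2 : (2 * N + 1 : ℝ) ≤ k := by exact_mod_cast hk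
  rw [← Real.mul_rpow hsK.le hkp.le]
  rcases (hr k).eq_or_lt with h0 | h0
  · rw [← h0]; positivity
  · have h1 := hind k (by omega) h0
    have h2 : s / (2 * K) * k ≤ r k ^ (-s) := by
      have h3 : s / (2 * K) * k = s / K * (k / 2) := by field_simp
      rw [h3]
      refine le_trans (mul_le_mul_of_nonneg_left ?_ (by positivity)) h1
      linarith
    have h4 := Real.rpow_le_rpow_of_nonpos (mul_pos hsK hkp) h2
      (by have : 0 < 1 / s := by positivity
          linarith : -(1 / s) ≤ 0)
    rwa [← Real.rpow_mul h0.le, show -s * -(1 / s) = 1 by field_simp, Real.rpow_one] at h4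

/-! ### Quadratic support functions and subgradients -/

namespace Variational

variable {E : Type*} [NormedAddCommGroup E] [InnerProductSpace ℝ E]

/-- `h` lies above the concave quadratic `y ↦ h x + ⟪D, y - x⟫ - C ‖y - x‖ ^ 2`. -/
def HasQuadraticSupport (h : E → EReal) (x D : E) (C : ℝ) : Prop :=
  ∀ y, h x + ((inner ℝ D (y - x) - C * ‖y - x‖ ^ 2 : ℝ) : EReal) ≤ h y

/-- Since `h y ≥ h x + g x - g y` at a minimizer, a quadratic majorant of `g` with slope `-D`
becomes a minorant of `h` with slope `D`; neither convexity nor differentiability of `h` enters. -/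
theorem HasQuadraticSupport.of_isArgmin {h : E → EReal} {g : E → ℝ} {x D : E} {C : ℝ}
    (hx : IsArgmin (fun y => h y + (g y : EReal)) x)
    (hg : ∀ y, g y ≤ g x - inner ℝ D (y - x) + C * ‖y - x‖ ^ 2) :
    HasQuadraticSupport h x D C := by
  intro y
  set a := inner ℝ D (y - x) - C * ‖y - x‖ ^ 2 with ha
  have h1 : h x + (a : EReal) = h x + (g x : EReal) + ((a - g x : ℝ) : EReal) := by
    rw [add_assoc, ← EReal.coe_add]; congr 2; ring
  have h2 : h y + (g y : EReal) + ((a - g x : ℝ) : EReal) ≤ h y := by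
    rw [add_assoc, ← EReal.coe_add]
    calc h y + ((g y + (a - g x) : ℝ) : EReal) ≤ h y + ((0 : ℝ) : EReal) := by
          gcongr
          linarith [hg y]
      _ = h y := by simp
  rw [h1]
  exact le_trans (add_le_add (hx y) le_rfl) h2

theorem HasQuadraticSupport.mono {h : E → EReal} {x D : E} {C C' : ℝ}
    (hs : HasQuadraticSupport h x D C) (hC : C ≤ C') : HasQuadraticSupport h x D C' := by
  intro y
  refine le_trans ?_ (hs y)
  gcongr

theorem HasQuadraticSupport.prod {F : Type*} [NormedAddCommGroup F] [InnerProductSpace ℝ F]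
    {h : E → EReal} {k : F → EReal} {x D : E} {y D' : F} {C : ℝ}
    (hx : HasQuadraticSupport h x D C) (hy : HasQuadraticSupport k y D' C) :
    HasQuadraticSupport (fun W : WithLp 2 (E × F) => h W.fst + k W.snd)
      (WithLp.toLp 2 (x, y)) (WithLp.toLp 2 (D, D')) C := by
  intro W
  refine le_trans (le_of_eq ?_) (add_le_add (hx W.fst) (hy W.snd))
  rw [add_add_add_comm, ← EReal.coe_add]
  congr 2
  rw [WithLp.prod_inner_apply, WithLp.prod_norm_sq_eq_of_L2]
  simp only [WithLp.ofLp_sub, Prod.fst_sub, Prod.snd_sub, WithLp.sub_fst, WithLp.sub_snd,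
    WithLp.toLp_fst, WithLp.toLp_snd]
  change inner ℝ D (W.fst - x) + inner ℝ D' (W.snd - y) - _ = _
  ring

/-- Sum rule: quadratic support plus a differentiable function. -/
theorem HasQuadraticSupport.add_mem_frechetSubdiff [CompleteSpace E] {h : E → EReal} {f : E → ℝ}
    {x D g : E} {C : ℝ} (hs : HasQuadraticSupport h x D C) (htop : h x ≠ ⊤) (hbot : h x ≠ ⊥)
    (hf : HasGradientAt f g x) :
    D + g ∈ frechetSubdiff (fun y => h y + (f y : EReal)) x := by
  refine ⟨EReal.add_ne_top htop (EReal.coe_ne_top _), ?_, fun ε hε => ?_⟩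
  · simp [EReal.add_eq_bot_iff, hbot]
  have h1 := (hasGradientAt_iff_isLittleO.mp hf).def (half_pos hε)
  have h2 : ∀ᶠ y in 𝓝 x, |C| * ‖y - x‖ ≤ ε / 2 := by
    have : Tendsto (fun y => |C| * ‖y - x‖) (𝓝 x) (𝓝 (|C| * ‖x - x‖)) := by
      refine Continuous.tendsto ?_ x
      fun_prop
    simp only [sub_self, norm_zero, mul_zero] at this
    exact this.eventually_le_const (half_pos hε)
  filter_upwards [h1, h2] with y hy1 hy2
  have h3 : f x + inner ℝ g (y - x) - ε / 2 * ‖y - x‖ ≤ f y := by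
    rw [Real.norm_eq_abs] at hy1
    linarith [(abs_le.mp hy1).1]
  have h4 : C * ‖y - x‖ ^ 2 ≤ ε / 2 * ‖y - x‖ := by
    calc C * ‖y - x‖ ^ 2 ≤ |C| * ‖y - x‖ ^ 2 := by gcongr; exact le_abs_self C
      _ = |C| * ‖y - x‖ * ‖y - x‖ := by ring
      _ ≤ _ := by gcongr
  calc h x + (f x : EReal) + ((inner ℝ (D + g) (y - x) - ε * ‖y - x‖ : ℝ) : EReal)
      = h x + ((f x + (inner ℝ (D + g) (y - x) - ε * ‖y - x‖) : ℝ) : EReal) := by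
        rw [add_assoc, ← EReal.coe_add]
    _ ≤ h x + ((inner ℝ D (y - x) - C * ‖y - x‖ ^ 2 + f y : ℝ) : EReal) := by
        refine add_le_add le_rfl (EReal.coe_le_coe_iff.2 ?_)
        rw [inner_add_left]
        linarith
    _ = h x + ((inner ℝ D (y - x) - C * ‖y - x‖ ^ 2 : ℝ) : EReal) + (f y : EReal) := by
        rw [add_assoc, ← EReal.coe_add]
    _ ≤ h y + (f y : EReal) := by gcongr; exact hs y

theorem frechetSubdiff_subset_subdiff (h : E → EReal) (x : E) :
    frechetSubdiff h x ⊆ subdiff h x := fun D hD =>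
  ⟨hD.1, hD.2.1, fun _ => x, fun _ => D, tendsto_const_nhds, tendsto_const_nhds,
    tendsto_const_nhds, fun _ => hD⟩

/-- Function values converge along points with uniform quadratic supports. -/
theorem tendsto_of_hasQuadraticSupport {ι : Type*} {l : Filter ι} {h : E → EReal} {u d : ι → E}
    {x : E} {C M : ℝ} (hlsc : LowerSemicontinuous h) (hx : h x ≠ ⊤) (hx' : h x ≠ ⊥)
    (hu : Tendsto u l (𝓝 x))
    (hs : ∀ᶠ i in l, HasQuadraticSupport h (u i) (d i) C) (hd : ∀ᶠ i in l, ‖d i‖ ≤ M) :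
    Tendsto (fun i => h (u i)) l (𝓝 (h x)) := by
  refine tendsto_order.2 ⟨fun a ha => hu.eventually (hlsc x a ha), fun a ha => ?_⟩
  lift h x to ℝ using ⟨hx, hx'⟩ with v hv
  have hnorm : Tendsto (fun i => ‖x - u i‖) l (𝓝 0) := by
    have := (tendsto_const_nhds (x := x)).sub hu
    simpa using this.norm
  have herr : Tendsto (fun i => v + (M * ‖x - u i‖ + C * ‖x - u i‖ ^ 2)) l (𝓝 v) := by
    have := ((hnorm.const_mul M).add ((hnorm.pow 2).const_mul C)).const_add v
    simpa using this
  have hE := (continuous_coe_real_ereal.tendsto v).comp herr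
  filter_upwards [hs, hd, hE.eventually_lt_const ha] with i h1 h2 h3
  refine lt_of_le_of_lt ?_ h3
  -- Lower semicontinuity gave the lower half of the limit; the upper half comes from evaluating the
  -- minorant based at `u i` at the limit point.
  have h4 := h1 x
  rw [← hv] at h4
  have h5 : -(M * ‖x - u i‖) ≤ inner ℝ (d i) (x - u i) := by
    have := neg_le_of_abs_le (abs_real_inner_le_norm (d i) (x - u i))
    have h6 : ‖d i‖ * ‖x - u i‖ ≤ M * ‖x - u i‖ := by gcongr
    linarith
  simp only [Function.comp]
  set e := inner ℝ (d i) (x - u i) - C * ‖x - u i‖ ^ 2 with he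
  calc h (u i) = h (u i) + (e : EReal) + ((-e : ℝ) : EReal) := by
        rw [add_assoc, ← EReal.coe_add]; simp
    _ ≤ (v : EReal) + ((-e : ℝ) : EReal) := by gcongr
    _ = ((v - e : ℝ) : EReal) := by rw [← EReal.coe_add]; rfl
    _ ≤ _ := by
        rw [EReal.coe_le_coe_iff]
        linarith

/-- The Kurdyka-Łojasiewicz inequality with a power desingularization, in real terms. -/
theorem KLInequalityAt.exists_rpow_le {h : E → EReal} {x₀ : E} {ν : EReal} {a θ v : ℝ}
    (hKL : KLInequalityAt h x₀ ν (fun t => a * t ^ (1 - θ))) (hν : 0 < ν) (ha : 0 < a)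
    (hθ : θ < 1) (hv : h x₀ = v) :
    ∃ V ∈ 𝓝 x₀, ∃ ε > (0 : ℝ), ∀ x ∈ V, ∀ u : ℝ, h x = u → v < u → u < v + ε →
      ∀ ξ ∈ subdiff h x, (u - v) ^ θ ≤ a * (1 - θ) * ‖ξ‖ := by
  obtain ⟨V, hV, H⟩ := hKL
  obtain ⟨ε, hε0, hεν⟩ := EReal.lt_iff_exists_real_btwn.mp hν
  have hε : 0 < ε := by exact_mod_cast hε0
  refine ⟨V, hV, ε, hε, fun x hx u hu hvu huv ξ hξ => ?_⟩
  have h1 := H x hx (by rw [hv, hu]; exact_mod_cast hvu) (by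
    rw [hv, hu]
    calc (u : EReal) < ((v + ε : ℝ) : EReal) := by exact_mod_cast huv
      _ = (v : EReal) + (ε : EReal) := EReal.coe_add _ _
      _ ≤ (v : EReal) + ν := by gcongr)
  have h2 : (h x - h x₀).toReal = u - v := by
    rw [hv, hu, ← EReal.coe_sub, EReal.toReal_coe]
  have hpos : 0 < u - v := by linarith
  have h3 : deriv (fun t : ℝ => a * t ^ (1 - θ)) (u - v) = a * (1 - θ) * (u - v) ^ (-θ) := by
    have := ((Real.hasDerivAt_rpow_const (p := 1 - θ) (Or.inl hpos.ne')).const_mul a).deriv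
    rw [this, show 1 - θ - 1 = -θ by ring]; ring
  rw [h2, h3] at h1
  have h4 : Metric.infEDist 0 (subdiff h x) ≤ ENNReal.ofReal ‖ξ‖ := by
    refine (Metric.infEDist_le_edist_of_mem hξ).trans (le_of_eq ?_)
    rw [edist_dist, dist_zero_left]
  have hnn : 0 ≤ a * (1 - θ) * (u - v) ^ (-θ) := by
    have : 0 < 1 - θ := by linarith
    positivity
  have h5 := h1.trans (mul_le_mul_right h4 _)
  rw [← ENNReal.ofReal_mul hnn, ENNReal.one_le_ofReal] at h5
  have h6 : (u - v) ^ θ * (u - v) ^ (-θ) = 1 := by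
    rw [← Real.rpow_add hpos]; simp
  have h7 : 0 ≤ (u - v) ^ θ := Real.rpow_nonneg hpos.le _
  calc (u - v) ^ θ ≤ (u - v) ^ θ * (a * (1 - θ) * (u - v) ^ (-θ) * ‖ξ‖) :=
        le_mul_of_one_le_right h7 h5
    _ = (u - v) ^ θ * (u - v) ^ (-θ) * (a * (1 - θ) * ‖ξ‖) := by ring
    _ = _ := by rw [h6, one_mul]

end Variational

theorem norm_le_of_forall_inner_le {F : Type*} [NormedAddCommGroup F] [InnerProductSpace ℝ F]
    {x : F} {C : ℝ} (hC : 0 ≤ C) (h : ∀ v : F, inner ℝ x v ≤ C * ‖v‖) : ‖x‖ ≤ C := by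
  have h1 := h x
  rw [real_inner_self_eq_norm_sq] at h1
  rcases (norm_nonneg x).eq_or_lt with h2 | h2
  · rwa [← h2]
  · nlinarith

/-! ### Matrix calculus in the Frobenius space -/

namespace RMat

variable {m n r : ℕ}

theorem mulT_apply (X : RMat m r) (Y : RMat n r) (i : Fin m) (j : Fin n) :
    mulT X Y (i, j) = ∑ k, X (i, k) * Y (j, k) := by
  simp [mulT, ofM, toM, Matrix.mul_apply]

@[simp] theorem col_apply (X : RMat m n) (j : Fin n) (i : Fin m) : col X j i = X (i, j) := rfl

theorem col_add (X Y : RMat m n) (j : Fin n) : col (X + Y) j = col X j + col Y j := rfl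

theorem col_sub (X Y : RMat m n) (j : Fin n) : col (X - Y) j = col X j - col Y j := rfl

theorem col_smul (a : ℝ) (X : RMat m n) (j : Fin n) : col (a • X) j = a • col X j := rfl

/-- The product `X Yᵀ` as a continuous bilinear map. -/
def mulTL (m n r : ℕ) : RMat m r →L[ℝ] RMat n r →L[ℝ] RMat m n :=
  LinearMap.toContinuousBilinearMap <| LinearMap.mk₂ ℝ mulT
    (fun X X' Y => by ext ⟨i, j⟩; simp [mulT_apply, add_mul, Finset.sum_add_distrib])
    (fun a X Y => by ext ⟨i, j⟩; simp [mulT_apply, mul_assoc, Finset.mul_sum])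
    (fun X Y Y' => by ext ⟨i, j⟩; simp [mulT_apply, mul_add, Finset.sum_add_distrib])
    (fun a X Y => by ext ⟨i, j⟩; simp [mulT_apply, mul_left_comm, Finset.mul_sum])

@[simp] theorem mulTL_apply (X : RMat m r) (Y : RMat n r) : mulTL m n r X Y = mulT X Y := rfl

theorem mulT_add_left (X X' : RMat m r) (Y : RMat n r) :
    mulT (X + X') Y = mulT X Y + mulT X' Y := by simp [← mulTL_apply]

theorem mulT_sub_left (X X' : RMat m r) (Y : RMat n r) :
    mulT (X - X') Y = mulT X Y - mulT X' Y := by simp [← mulTL_apply]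

theorem norm_mulT_le (X : RMat m r) (Y : RMat n r) :
    ‖mulT X Y‖ ≤ ‖mulTL m n r‖ * ‖Y‖ * ‖X‖ := by
  rw [← mulTL_apply, mul_right_comm]
  exact (mulTL m n r).le_opNorm₂ X Y

theorem inner_def (X Y : RMat m n) : inner ℝ X Y = ∑ i, ∑ j, X (i, j) * Y (i, j) := by
  rw [PiLp.inner_apply, Fintype.sum_prod_type]
  simp [mul_comm]

theorem inner_mulT_left (G : RMat m n) (X : RMat m r) (Y : RMat n r) :
    inner ℝ G (mulT X Y) = inner ℝ (ofM (toM G * toM Y)) X := by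
  simp only [inner_def, mulT_apply, ofM, toM, Matrix.mul_apply, Matrix.of_apply, Finset.mul_sum,
    Finset.sum_mul]
  refine Finset.sum_congr rfl fun i _ => ?_
  rw [Finset.sum_comm]
  exact Finset.sum_congr rfl fun k _ => Finset.sum_congr rfl fun j _ => by ring

theorem inner_mulT_right (G : RMat m n) (X : RMat m r) (Y : RMat n r) :
    inner ℝ G (mulT X Y) = inner ℝ (ofM ((toM G).transpose * toM X)) Y := by
  simp only [inner_def, mulT_apply, ofM, toM, Matrix.mul_apply, Matrix.of_apply, Finset.mul_sum,
    Finset.sum_mul, Matrix.transpose_apply]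
  rw [Finset.sum_comm]
  refine Finset.sum_congr rfl fun j _ => ?_
  rw [Finset.sum_comm]
  exact Finset.sum_congr rfl fun k _ => Finset.sum_congr rfl fun i _ => by ring

theorem inner_eq_sum_col (X Y : RMat m n) : inner ℝ X Y = ∑ j, inner ℝ (col X j) (col Y j) := by
  rw [inner_def, Finset.sum_comm]
  simp [PiLp.inner_apply, mul_comm]

theorem norm_sq_eq_sum_col (X : RMat m n) : ‖X‖ ^ 2 = ∑ j, ‖col X j‖ ^ 2 := by
  simp only [← real_inner_self_eq_norm_sq, inner_eq_sum_col]

theorem norm_col_le (X : RMat m n) (j : Fin n) : ‖col X j‖ ≤ ‖X‖ := by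
  refine le_of_sq_le_sq ?_ (norm_nonneg _)
  rw [norm_sq_eq_sum_col X]
  exact Finset.single_le_sum (f := fun j => ‖col X j‖ ^ 2) (fun _ _ => sq_nonneg _)
    (Finset.mem_univ j)

/-- The matrix with `j`-th column `v` and all other columns zero. -/
def ofCol (j : Fin n) (v : RVec m) : RMat m n :=
  WithLp.toLp 2 fun p => if p.2 = j then v p.1 else 0

theorem inner_ofCol (X : RMat m n) (j : Fin n) (v : RVec m) :
    inner ℝ X (ofCol j v) = inner ℝ (col X j) v := by
  rw [inner_def]
  simp [ofCol, PiLp.inner_apply, mul_comm]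

theorem norm_ofCol (j : Fin n) (v : RVec m) : ‖ofCol j v‖ = ‖v‖ := by
  have h : ‖ofCol j v‖ ^ 2 = ‖v‖ ^ 2 := by
    rw [← real_inner_self_eq_norm_sq, inner_ofCol, ← real_inner_self_eq_norm_sq]
    congr 1
    ext i
    simp [ofCol]
  exact (sq_eq_sq₀ (norm_nonneg _) (norm_nonneg _)).mp h

theorem eq_sum_ofCol (X : RMat m n) : X = ∑ j, ofCol j (col X j) := by
  ext ⟨i, j⟩
  simp [ofCol]

theorem norm_le_of_norm_col_le {X : RMat m n} {C : ℝ} (h : ∀ j, ‖col X j‖ ≤ C) :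
    ‖X‖ ≤ n * C := by
  calc ‖X‖ = ‖∑ j, ofCol j (col X j)‖ := by rw [← eq_sum_ofCol]
    _ ≤ ∑ j : Fin n, C := norm_sum_le_of_le _ fun j _ => by rw [norm_ofCol]; exact h j
    _ = n * C := by simp

theorem hybrid_eq_add_ofCol (U X : RMat m n) (j : Fin n) (v u : RVec m) :
    hybrid U X j v = hybrid U X j u + ofCol j (v - u) := by
  ext ⟨a, k⟩
  simp only [hybrid, ofM, ofCol, Matrix.of_apply, PiLp.add_apply, PiLp.sub_apply]
  split_ifs with h1 h2
  · exact absurd h2 h1.ne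
  all_goals simp

/-- Every entry of the difference is either the corresponding entry of `U - X` or zero. -/
theorem norm_hybrid_sub_le (U X : RMat m n) (j : Fin n) :
    ‖hybrid U X j (col U j) - X‖ ≤ ‖U - X‖ := by
  rw [EuclideanSpace.norm_eq, EuclideanSpace.norm_eq]
  refine Real.sqrt_le_sqrt (Finset.sum_le_sum fun p _ => ?_)
  obtain ⟨a, k⟩ := p
  simp only [hybrid, ofM, Matrix.of_apply, PiLp.sub_apply, col_apply]
  split_ifs with h1 h2
  · exact le_rfl
  · rw [h2]
  · simp [sq_nonneg]

/-- The transpose in the Frobenius space. -/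
def tr (X : RMat m n) : RMat n m := ofM (toM X).transpose

theorem norm_tr (X : RMat m n) : ‖tr X‖ = ‖X‖ := by
  rw [EuclideanSpace.norm_eq, EuclideanSpace.norm_eq, Fintype.sum_prod_type,
    Fintype.sum_prod_type_right]
  rfl

theorem tr_sub (X Y : RMat m n) : tr (X - Y) = tr X - tr Y := rfl

theorem tr_mulT (X : RMat m r) (Y : RMat n r) : tr (mulT X Y) = mulT Y X := by
  simp [tr, mulT, toM, ofM, Matrix.mul_apply, mul_comm]

/-- A linear map on a finite-dimensional space is bounded; no sharp constant is needed, only bounded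
caps on bounded sets. -/
theorem exists_specNorm_le (m n : ℕ) : ∃ C : ℝ, 0 ≤ C ∧ ∀ X : RMat m n, specNorm X ≤ C * ‖X‖ := by
  let L : RMat m n →ₗ[ℝ] (RVec n →L[ℝ] RVec m) :=
    { toFun := fun X => LinearMap.toContinuousLinearMap (Matrix.toEuclideanLin (toM X))
      map_add' := fun X Y => by
        rw [← map_add, ← map_add]; rfl
      map_smul' := fun a X => by
        rw [← map_smul, ← map_smul]; rfl }
  exact ⟨‖LinearMap.toContinuousLinearMap L‖, norm_nonneg (LinearMap.toContinuousLinearMap L),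
    fun X => (LinearMap.toContinuousLinearMap L).le_opNorm X⟩

theorem specNorm_nonneg (X : RMat m n) : 0 ≤ specNorm X := norm_nonneg _

end RMat

/-! ### Optimality conditions of the updates -/

/-- The three squares expand exactly around `u`; only the second-order terms are estimated, with
absolute values because `α` may be negative. The abstract spaces let one computation serve all
updates: whole matrices, single columns, and, with `α = 0`, the prox-linear model. -/
theorem proximal_model_le {F M : Type*} [NormedAddCommGroup F] [InnerProductSpace ℝ F]
    [NormedAddCommGroup M] [InnerProductSpace ℝ M] {α lam μ N : ℝ} {u w x y d : F} {z z' : M}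
    (hd : inner ℝ d w = α * inner ℝ z z') (hz : ‖z'‖ ≤ N * ‖w‖) :
    α / 2 * ‖z + z'‖ ^ 2 + lam / 2 * ‖u + w - y‖ ^ 2 + μ / 2 * ‖u + w - x‖ ^ 2 ≤
      α / 2 * ‖z‖ ^ 2 + lam / 2 * ‖u - y‖ ^ 2 + μ / 2 * ‖u - x‖ ^ 2
        - inner ℝ (-(d + lam • (u - y) + μ • (u - x))) w
        + (|α| * N ^ 2 + |lam| + |μ|) * ‖w‖ ^ 2 := by
  have h1 : ‖z + z'‖ ^ 2 = ‖z‖ ^ 2 + 2 * inner ℝ z z' + ‖z'‖ ^ 2 := norm_add_sq_real z z'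
  have h2 : ‖u + w - y‖ ^ 2 = ‖u - y‖ ^ 2 + 2 * inner ℝ (u - y) w + ‖w‖ ^ 2 := by
    rw [add_sub_right_comm]; exact norm_add_sq_real _ _
  have h3 : ‖u + w - x‖ ^ 2 = ‖u - x‖ ^ 2 + 2 * inner ℝ (u - x) w + ‖w‖ ^ 2 := by
    rw [add_sub_right_comm]; exact norm_add_sq_real _ _
  rw [h1, h2, h3, inner_neg_left, inner_add_left, inner_add_left, real_inner_smul_left,
    real_inner_smul_left, hd]
  have h4 : ‖z'‖ ^ 2 ≤ N ^ 2 * ‖w‖ ^ 2 := by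
    rw [← mul_pow]; exact pow_le_pow_left₀ (norm_nonneg _) hz 2
  have h5 : α / 2 * ‖z'‖ ^ 2 ≤ |α| * (N ^ 2 * ‖w‖ ^ 2) := by
    have h6 : α / 2 ≤ |α| := by linarith [le_abs_self α, abs_nonneg α]
    calc α / 2 * ‖z'‖ ^ 2 ≤ |α| * ‖z'‖ ^ 2 := by gcongr
      _ ≤ _ := by gcongr
  have h7 : lam / 2 * ‖w‖ ^ 2 ≤ |lam| * ‖w‖ ^ 2 := by
    gcongr; linarith [le_abs_self lam, abs_nonneg lam]
  have h8 : μ / 2 * ‖w‖ ^ 2 ≤ |μ| * ‖w‖ ^ 2 := by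
    gcongr; linarith [le_abs_self μ, abs_nonneg μ]
  linarith

namespace GSMF

variable {n r q : ℕ}

theorem inner_gradXH (α : ℝ) (X Y : RMat n r) (Z : RMat n n) (V : RMat n r) :
    inner ℝ (gradXH α X Y Z) V = α * inner ℝ (mulT X Y - Z) (mulT V Y) := by
  rw [gradXH, real_inner_smul_left, inner_mulT_left]

theorem inner_gradYH (α : ℝ) (X Y : RMat n r) (Z : RMat n n) (V : RMat n r) :
    inner ℝ (gradYH α X Y Z) V = α * inner ℝ (mulT X Y - Z) (mulT X V) := by
  rw [gradYH, real_inner_smul_left, inner_mulT_right]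

theorem norm_gradXH_sub_le (α : ℝ) (U X Y : RMat n r) (Z : RMat n n) :
    ‖gradXH α U Y Z - gradXH α X Y Z‖ ≤ |α| * (‖mulTL n n r‖ * ‖Y‖) ^ 2 * ‖U - X‖ := by
  refine norm_le_of_forall_inner_le (by positivity) fun v => ?_
  rw [inner_sub_left, inner_gradXH, inner_gradXH, ← mul_sub, ← inner_sub_left,
    sub_sub_sub_cancel_right, ← mulT_sub_left]
  calc α * inner ℝ (mulT (U - X) Y) (mulT v Y)
      ≤ |α| * |inner ℝ (mulT (U - X) Y) (mulT v Y)| := by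
        rw [← abs_mul]; exact le_abs_self _
    _ ≤ |α| * (‖mulT (U - X) Y‖ * ‖mulT v Y‖) := by
        gcongr; exact abs_real_inner_le_norm _ _
    _ ≤ |α| * ((‖mulTL n n r‖ * ‖Y‖ * ‖U - X‖) * (‖mulTL n n r‖ * ‖Y‖ * ‖v‖)) := by
        gcongr <;> exact norm_mulT_le _ _
    _ = _ := by ring

theorem IsColumnSplitting.hasQuadraticSupport {Ψ : RMat n r → EReal} {ψ : Fin r → RVec n → EReal}
    (hs : IsColumnSplitting Ψ ψ) {U D : RMat n r} {C : ℝ}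
    (h : ∀ i, HasQuadraticSupport (ψ i) (col U i) (col D i) C) :
    HasQuadraticSupport Ψ U D C := by
  intro X
  rw [hs.sum_eq, hs.sum_eq, inner_eq_sum_col, norm_sq_eq_sum_col, Finset.mul_sum,
    ← Finset.sum_sub_distrib]
  have hcoe : ∀ f : Fin r → ℝ, ((∑ i, f i : ℝ) : EReal) = ∑ i, (f i : EReal) := fun f =>
    map_sum (⟨⟨((↑) : ℝ → EReal), EReal.coe_zero⟩, EReal.coe_add⟩ : ℝ →+ EReal) f Finset.univ
  rw [hcoe, ← Finset.sum_add_distrib]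
  exact Finset.sum_le_sum fun i _ => h i (col X i)

/-- Each kind of `X`-update produces a point with a quadratic support of `Ψ` whose slope is close
to the partial gradient at the current iterate. -/
theorem XUpdate.exists_hasQuadraticSupport {P : GSMF n r q} {α μ : ℝ} {X Y U : RMat n r}
    {Z : RMat n n} (h : P.XUpdate α X Y Z μ U) {L : ℝ}
    (hL : |α| * (‖mulTL n n r‖ * ‖Y‖) ^ 2 + |P.lam| + |μ| ≤ L) :
    ∃ D, HasQuadraticSupport P.Ψ U D L ∧
      ‖D + gradXH α X Y Z + P.lam • (X - Y)‖ ≤ (r + 1) * L * ‖U - X‖ := by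
  set N := ‖mulTL n n r‖ * ‖Y‖ with hN
  have hL0 : 0 ≤ L := le_trans (by positivity) hL
  have hr1 : (1 : ℝ) ≤ r + 1 := by linarith [Nat.cast_nonneg (α := ℝ) r]
  have hbase : L * ‖U - X‖ ≤ (r + 1) * L * ‖U - X‖ := by
    gcongr; exact le_mul_of_one_le_left hL0 hr1
  rcases h with h | h | ⟨ψ, hψ, h⟩
  · refine ⟨-(gradXH α U Y Z + P.lam • (U - Y) + μ • (U - X)),
      (HasQuadraticSupport.of_isArgmin h fun V => ?_).mono hL, ?_⟩
    · have h1 := proximal_model_le (α := α) (lam := P.lam) (μ := μ) (N := N) (u := U)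
        (w := V - U) (x := X) (y := Y) (d := gradXH α U Y Z) (z := mulT U Y - Z)
        (z' := mulT (V - U) Y) (inner_gradXH _ _ _ _ _) (norm_mulT_le _ _)
      have h2 : mulT U Y - Z + mulT (V - U) Y = mulT V Y - Z := by rw [mulT_sub_left]; abel
      rw [h2, add_sub_cancel] at h1
      exact h1
    · refine le_trans ?_ hbase
      have h1 : -(gradXH α U Y Z + P.lam • (U - Y) + μ • (U - X)) + gradXH α X Y Z
          + P.lam • (X - Y) = -((gradXH α U Y Z - gradXH α X Y Z) + P.lam • (U - X)
            + μ • (U - X)) := by module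
      rw [h1, norm_neg]
      calc _ ≤ ‖gradXH α U Y Z - gradXH α X Y Z‖ + ‖P.lam • (U - X)‖ + ‖μ • (U - X)‖ :=
            norm_add₃_le
        _ ≤ |α| * N ^ 2 * ‖U - X‖ + |P.lam| * ‖U - X‖ + |μ| * ‖U - X‖ := by
            rw [norm_smul, norm_smul, Real.norm_eq_abs, Real.norm_eq_abs]
            gcongr
            exact norm_gradXH_sub_le _ _ _ _ _
        _ = (|α| * N ^ 2 + |P.lam| + |μ|) * ‖U - X‖ := by ring
        _ ≤ _ := by gcongr
  · refine ⟨-(gradXH α X Y Z + P.lam • (U - Y) + μ • (U - X)),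
      (HasQuadraticSupport.of_isArgmin h fun V => ?_).mono hL, ?_⟩
    -- The linearized term is affine and contributes its slope exactly, so only the two proximity
    -- terms go through the quadratic model.
    · have h1 := proximal_model_le (M := ℝ) (α := 0) (lam := P.lam) (μ := μ) (N := 0) (u := U)
        (w := V - U) (x := X) (y := Y) (d := 0) (z := 0) (z' := 0) (by simp) (by simp)
      rw [add_sub_cancel] at h1
      have h3 : inner ℝ (gradXH α X Y Z) (V - X) = inner ℝ (gradXH α X Y Z) (U - X)
          + inner ℝ (gradXH α X Y Z) (V - U) := by rw [← inner_add_right]; congr 1; abel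
      have h4 : 0 ≤ |α| * N ^ 2 * ‖V - U‖ ^ 2 := by positivity
      simp only [inner_neg_left, inner_add_left, inner_zero_left, abs_zero, zero_mul, zero_div]
        at h1 h3 ⊢
      linarith
    · refine le_trans ?_ hbase
      have h1 : -(gradXH α X Y Z + P.lam • (U - Y) + μ • (U - X)) + gradXH α X Y Z
          + P.lam • (X - Y) = -(P.lam • (U - X) + μ • (U - X)) := by module
      rw [h1, norm_neg]
      calc _ ≤ ‖P.lam • (U - X)‖ + ‖μ • (U - X)‖ := norm_add_le _ _
        _ = (|P.lam| + |μ|) * ‖U - X‖ := by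
            rw [norm_smul, norm_smul, Real.norm_eq_abs, Real.norm_eq_abs]; ring
        _ ≤ _ := by
            gcongr
            have : 0 ≤ |α| * N ^ 2 := by positivity
            linarith
  -- `T i` is the matrix in force once column `i` has been updated. The slope is assembled
  -- columnwise, column `i` from the gradient at `T i`; summing column norms costs the factor `r`.
  · set T := fun i => hybrid U X i (col U i) with hT
    set D : RMat n r := WithLp.toLp 2 fun p =>
      (-(col (gradXH α (T p.2) Y Z) p.2 + P.lam • (col U p.2 - col Y p.2)
        + μ • (col U p.2 - col X p.2))) p.1 with hD
    have hDcol : ∀ i, col D i = -(col (gradXH α (T i) Y Z) i + P.lam • (col U i - col Y i)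
        + μ • (col U i - col X i)) := fun i => rfl
    refine ⟨D, hψ.hasQuadraticSupport fun i =>
      (HasQuadraticSupport.of_isArgmin (h i) fun v => ?_).mono hL, ?_⟩
    · have h1 := proximal_model_le (α := α) (lam := P.lam) (μ := μ) (N := N) (u := col U i)
        (w := v - col U i) (x := col X i) (y := col Y i) (d := col (gradXH α (T i) Y Z) i)
        (z := mulT (T i) Y - Z) (z' := mulT (ofCol i (v - col U i)) Y)
        (by rw [← inner_ofCol, inner_gradXH])
        (by rw [← norm_ofCol i (v - col U i)]; exact norm_mulT_le _ _)
      have h2 : mulT (T i) Y - Z + mulT (ofCol i (v - col U i)) Y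
          = mulT (hybrid U X i v) Y - Z := by
        rw [hybrid_eq_add_ofCol U X i v (col U i), mulT_add_left]; abel
      rw [h2, add_sub_cancel, ← hDcol] at h1
      exact h1
    · have hcol : ∀ i, ‖col (D + gradXH α X Y Z + P.lam • (X - Y)) i‖ ≤ L * ‖U - X‖ := by
        intro i
        have h1 : col (D + gradXH α X Y Z + P.lam • (X - Y)) i =
            -(col (gradXH α (T i) Y Z - gradXH α X Y Z) i + P.lam • col (U - X) i
              + μ • col (U - X) i) := by
          simp only [col_add, col_sub, col_smul, hDcol]
          module
        rw [h1, norm_neg]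
        calc _ ≤ ‖col (gradXH α (T i) Y Z - gradXH α X Y Z) i‖ + ‖P.lam • col (U - X) i‖
              + ‖μ • col (U - X) i‖ := norm_add₃_le
          _ ≤ |α| * N ^ 2 * ‖U - X‖ + |P.lam| * ‖U - X‖ + |μ| * ‖U - X‖ := by
              rw [norm_smul, norm_smul, Real.norm_eq_abs, Real.norm_eq_abs]
              gcongr
              · refine (norm_col_le _ _).trans ((norm_gradXH_sub_le _ _ _ _ _).trans ?_)
                gcongr
                exact norm_hybrid_sub_le _ _ _
              · exact norm_col_le _ _
              · exact norm_col_le _ _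
          _ = (|α| * N ^ 2 + |P.lam| + |μ|) * ‖U - X‖ := by ring
          _ ≤ _ := by gcongr
      refine (norm_le_of_norm_col_le hcol).trans ?_
      have : 0 ≤ L * ‖U - X‖ := by positivity
      linarith

theorem H_eq_H_tr (α : ℝ) (X Y : RMat n r) (Z : RMat n n) : H α X Y Z = H α Y X (tr Z) := by
  rw [H, H, ← norm_tr (mulT X Y - Z), tr_sub, tr_mulT]

theorem gradYH_eq_gradXH_tr (α : ℝ) (X Y : RMat n r) (Z : RMat n n) :
    gradYH α X Y Z = gradXH α Y X (tr Z) := by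
  rw [gradYH, gradXH, ← tr_mulT X Y, ← tr_sub]
  rfl

/-- Transposing `X Yᵀ - Z` preserves the Frobenius norm and exchanges the factors, so the
`X`-estimate also covers `Y`. -/
theorem YUpdate.toXUpdate {P : GSMF n r q} {α σ : ℝ} {U Y V : RMat n r} {Z : RMat n n}
    (h : P.YUpdate α U Y Z σ V) :
    XUpdate { P with Ψ := P.Φ } α Y U (tr Z) σ V := by
  simpa only [YUpdate, XUpdate, H_eq_H_tr α U, gradYH_eq_gradXH_tr, norm_sub_rev U,
    norm_sub_rev (col U _)] using h

theorem YUpdate.exists_hasQuadraticSupport {P : GSMF n r q} {α σ : ℝ} {U Y V : RMat n r}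
    {Z : RMat n n} (h : P.YUpdate α U Y Z σ V) {L : ℝ}
    (hL : |α| * (‖mulTL n n r‖ * ‖U‖) ^ 2 + |P.lam| + |σ| ≤ L) :
    ∃ D, HasQuadraticSupport P.Φ V D L ∧
      ‖D + gradYH α U Y Z + P.lam • (Y - U)‖ ≤ (r + 1) * L * ‖V - Y‖ := by
  rw [gradYH_eq_gradXH_tr]
  exact h.toXUpdate.exists_hasQuadraticSupport hL

end GSMF

/-! ### Descent with averaged reference values -/

/-- A sequence `W` with objective values `v` and averaged reference values `R` that satisfies the
sufficient decrease condition with respect to `R`. -/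
structure AveragedDescent {E : Type*} [PseudoMetricSpace E] (W : ℕ → E) (v R : ℕ → ℝ)
    (c pm m : ℝ) : Prop where
  c_pos : 0 < c
  pm_pos : 0 < pm
  init : R 0 = v 0
  bdd : ∀ k, m ≤ v k
  descent : ∀ k, v (k + 1) ≤ R k - c / 2 * dist (W k) (W (k + 1)) ^ 2
  average : ∀ k, ∃ p, pm ≤ p ∧ p ≤ 1 ∧ R (k + 1) = (1 - p) * R k + p * v (k + 1)

namespace AveragedDescent

variable {E : Type*} [PseudoMetricSpace E] {W : ℕ → E} {v R : ℕ → ℝ} {c pm m : ℝ}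

theorem sub_le (h : AveragedDescent W v R c pm m) (k : ℕ) :
    R k - v (k + 1) ≤ (R k - R (k + 1)) / pm ∧
      dist (W k) (W (k + 1)) ^ 2 ≤ 2 / (c * pm) * (R k - R (k + 1)) := by
  obtain ⟨p, hp, -, hR⟩ := h.average k
  exact averaged_decrease h.c_pos h.pm_pos hp hR (h.descent k)

theorem antitone (h : AveragedDescent W v R c pm m) : Antitone R := by
  refine antitone_nat_of_succ_le fun k => ?_
  have h1 := (sq_nonneg _).trans (h.sub_le k).2
  have hc := h.c_pos
  have hp := h.pm_pos
  have := nonneg_of_mul_nonneg_right h1 (by positivity)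
  linarith

theorem le_ref (h : AveragedDescent W v R c pm m) (k : ℕ) : v k ≤ R k := by
  cases k with
  | zero => exact h.init.ge
  | succ k =>
    obtain ⟨p, hp, hp1, hR⟩ := h.average k
    have h2 : v (k + 1) ≤ R k := by
      have h3 := h.descent k
      have h4 : 0 ≤ c / 2 * dist (W k) (W (k + 1)) ^ 2 := by
        have := h.c_pos
        positivity
      linarith
    rw [hR]
    nlinarith

/-- `R` is antitone and bounded below by `m ≤ v ≤ R`. The nonmonotone `v (k + 1)` is squeezed
between `R k - (R k - R (k + 1)) / pm` and `R (k + 1)`. -/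
theorem exists_tendsto (h : AveragedDescent W v R c pm m) :
    ∃ l, Tendsto R atTop (𝓝 l) ∧ (∀ k, l ≤ R k) ∧ Tendsto v atTop (𝓝 l) ∧
      Tendsto (fun k => dist (W k) (W (k + 1))) atTop (𝓝 0) := by
  have hb : BddBelow (Set.range R) := ⟨m, by
    rintro _ ⟨k, rfl⟩
    exact (h.bdd k).trans (h.le_ref k)⟩
  have hR := tendsto_atTop_ciInf h.antitone hb
  have hdiff : Tendsto (fun k => R k - R (k + 1)) atTop (𝓝 0) := by
    simpa using hR.sub ((tendsto_add_atTop_iff_nat 1).mpr hR)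
  refine ⟨_, hR, fun k => ciInf_le hb k, ?_, ?_⟩
  · rw [← tendsto_add_atTop_iff_nat 1]
    have h1 : Tendsto (fun k => R k - (R k - R (k + 1)) / pm) atTop (𝓝 (⨅ i, R i)) := by
      simpa using hR.sub (hdiff.div_const pm)
    refine tendsto_of_tendsto_of_tendsto_of_le_of_le h1
      ((tendsto_add_atTop_iff_nat 1).mpr hR) (fun k => ?_) (fun k => h.le_ref (k + 1))
    linarith [(h.sub_le k).1]
  · have h1 : Tendsto (fun k => √(2 / (c * pm) * (R k - R (k + 1)))) atTop (𝓝 0) := by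
      have := (hdiff.const_mul (2 / (c * pm))).sqrt
      simpa using this
    exact squeeze_zero (fun k => dist_nonneg) (fun k => Real.le_sqrt_of_sq_le (h.sub_le k).2) h1

end AveragedDescent

/-! ### Abstract convergence theorem: nonsmooth plus smooth objective under KL -/

section Abstract

variable {E : Type*} [NormedAddCommGroup E] [InnerProductSpace ℝ E] [CompleteSpace E]

/-- At a cluster point of iterates with approximately stationary quadratic supports, the objective
has the limiting value and zero is a limiting subgradient. -/
theorem zero_mem_subdiff_of_mapClusterPt {h : E → EReal} {f : E → ℝ} {G : E → E} {W : ℕ → E}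
    {v : ℕ → ℝ} {l L C : ℝ} {w : E} (hlsc : LowerSemicontinuous h) (hbot : ∀ x, h x ≠ ⊥)
    (hf : ∀ x, HasGradientAt f (G x) x) (hG : Continuous G)
    (hv : ∀ k, h (W k) + (f (W k) : EReal) = v k) (hvl : Tendsto v atTop (𝓝 l))
    (hΔ : Tendsto (fun k => dist (W k) (W (k + 1))) atTop (𝓝 0))
    (hs : ∀ k, ∃ D, HasQuadraticSupport h (W (k + 1)) D L ∧
      ‖D + G (W (k + 1))‖ ≤ C * dist (W k) (W (k + 1)))
    (hcl : MapClusterPt w atTop W) :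
    h w + (f w : EReal) = l ∧ 0 ∈ subdiff (fun y => h y + (f y : EReal)) w := by
  obtain ⟨ψ, hψ, hψw⟩ := hcl.tendsto_subseq
  choose D hD1 hD2 using hs
  -- Supports are given only at indices `k + 1`; shifting the subsequence makes `ψ (j + 1) ≥ 1`, so
  -- a predecessor exists.
  set s : ℕ → ℕ := fun j => ψ (j + 1) - 1 with hsdef
  have hs1 : ∀ j, s j + 1 = ψ (j + 1) := fun j => by
    have := hψ.id_le (j + 1)
    simp only [id, hsdef] at this ⊢
    omega
  have hs_top : Tendsto s atTop atTop := by
    refine tendsto_atTop_mono (fun j => ?_) tendsto_id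
    have := hψ.id_le (j + 1)
    simp only [id, hsdef] at this ⊢
    omega
  have hu : Tendsto (fun j => W (s j + 1)) atTop (𝓝 w) := by
    simp only [hs1]
    exact (tendsto_add_atTop_iff_nat 1).mpr hψw
  have hfc : Tendsto (fun j => f (W (s j + 1))) atTop (𝓝 (f w)) :=
    ((hf w).differentiableAt.continuousAt.tendsto).comp hu
  have hvs : Tendsto (fun j => v (s j + 1)) atTop (𝓝 l) :=
    hvl.comp ((tendsto_add_atTop_nat 1).comp hs_top)
  have hval : ∀ k, h (W k) = ((v k - f (W k) : ℝ) : EReal) := by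
    intro k
    have h1 := hv k
    have h2 : h (W k) = h (W k) + (f (W k) : EReal) + ((-f (W k) : ℝ) : EReal) := by
      rw [add_assoc, ← EReal.coe_add]; simp
    rw [h2, h1, ← EReal.coe_add]; rfl
  have hht : Tendsto (fun j => h (W (s j + 1))) atTop (𝓝 ((l - f w : ℝ) : EReal)) := by
    simp only [hval]
    exact (continuous_coe_real_ereal.tendsto _).comp (hvs.sub hfc)
  -- Lower semicontinuity alone puts `w` in the domain; equality then follows from the uniform
  -- supports, whose slopes converge to `-G w`.
  have hle : h w ≤ ((l - f w : ℝ) : EReal) := by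
    by_contra! hlt
    obtain ⟨a, ha1, ha2⟩ := exists_between hlt
    have h1 := hu.eventually (hlsc w a ha2)
    have h2 := hht.eventually_lt_const ha1
    obtain ⟨j, h3, h4⟩ := (h1.and h2).exists
    exact lt_asymm h3 h4
  have htop : h w ≠ ⊤ := ne_top_of_le_ne_top (EReal.coe_ne_top _) hle
  have hξ : Tendsto (fun j => D (s j) + G (W (s j + 1))) atTop (𝓝 0) := by
    refine squeeze_zero_norm (fun j => hD2 (s j)) ?_
    simpa using (hΔ.comp hs_top).const_mul C
  have hGw : Tendsto (fun j => G (W (s j + 1))) atTop (𝓝 (G w)) := (hG.tendsto w).comp hu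
  have hDlim : Tendsto (fun j => D (s j)) atTop (𝓝 (0 - G w)) := by
    simpa using hξ.sub hGw
  have hDb : ∀ᶠ j in atTop, ‖D (s j)‖ ≤ ‖0 - G w‖ + 1 :=
    hDlim.norm.eventually_le_const (by linarith)
  have hlim := tendsto_of_hasQuadraticSupport hlsc htop (hbot w) hu
    (Eventually.of_forall fun j => hD1 (s j)) hDb
  have hw : h w = ((l - f w : ℝ) : EReal) := tendsto_nhds_unique hlim hht
  have hFw : h w + (f w : EReal) = l := by
    rw [hw, ← EReal.coe_add]; simp
  refine ⟨hFw, ?_⟩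
  refine ⟨?_, ?_, fun j => W (s j + 1), fun j => D (s j) + G (W (s j + 1)), hu, ?_, hξ, ?_⟩
  · simp only [hFw]; exact EReal.coe_ne_top _
  · simp only [hFw]; exact EReal.coe_ne_bot _
  · simp only [hv, hFw]
    exact (continuous_coe_real_ereal.tendsto _).comp hvs
  · intro j
    refine (hD1 (s j)).add_mem_frechetSubdiff ?_ (hbot _) (hf _)
    rw [hval]; exact EReal.coe_ne_top _

/-- Convergence and rates for averaged descent under the Kurdyka-Łojasiewicz inequality at a
cluster point. -/
theorem AveragedDescent.tendsto_and_rate {h : E → EReal} {f : E → ℝ} {G : E → E} {W : ℕ → E}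
    {v R : ℕ → ℝ} {c pm m L C θ : ℝ} {w : E} (hd : AveragedDescent W v R c pm m)
    (hlsc : LowerSemicontinuous h) (hbot : ∀ x, h x ≠ ⊥)
    (hf : ∀ x, HasGradientAt f (G x) x) (hG : Continuous G)
    (hv : ∀ k, h (W k) + (f (W k) : EReal) = v k)
    (hs : ∀ k, ∃ D, HasQuadraticSupport h (W (k + 1)) D L ∧
      ‖D + G (W (k + 1))‖ ≤ C * dist (W k) (W (k + 1)))
    (hθ1 : θ < 1) (hKL : IsKLWithExponent (fun y => h y + (f y : EReal)) θ)
    (hcl : MapClusterPt w atTop W) :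
    Tendsto W atTop (𝓝 w) ∧
    (θ ≤ 1 / 2 → ∃ d ϱ : ℝ, 0 < d ∧ 0 < ϱ ∧ ϱ < 1 ∧ ∀ᶠ k : ℕ in atTop, dist (W k) w ≤ d * ϱ ^ k) ∧
    (1 / 2 < θ → ∃ d : ℝ, 0 < d ∧ ∀ᶠ k : ℕ in atTop,
      dist (W k) w ≤ d * (k : ℝ) ^ (-((1 - θ) / (2 * θ - 1)))) := by
  obtain ⟨l, hRl, hlR, hvl, hΔ⟩ := hd.exists_tendsto
  obtain ⟨hFw, h0⟩ := zero_mem_subdiff_of_mapClusterPt hlsc hbot hf hG hv hvl hΔ hs hcl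
  obtain ⟨ν, a, hν, ha, hKLw⟩ := hKL w ⟨0, h0⟩
  obtain ⟨V, hV, ε, hε, hKL'⟩ := hKLw.exists_rpow_le hν ha hθ1 hFw
  obtain ⟨η, hη, hηV⟩ := Metric.mem_nhds_iff.mp hV
  have hc := hd.c_pos
  have hpm := hd.pm_pos
  -- For value gaps at most 1 a KL exponent may be enlarged, so all `θ ≤ 1 / 2` reduce to `1 / 2`;
  -- this is why gaps are kept below `min ε 1`.
  set θ' := max θ (1 / 2) with hθ'
  have hθ'2 : 1 / 2 ≤ θ' := le_max_right _ _
  have hθ'1 : θ' < 1 := max_lt hθ1 (by norm_num)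
  set C' := a * (1 - θ) * C with hC'
  set K := 8 * C' ^ 2 / (c * pm) + 2 / pm + 2 / (c * pm) with hK
  have hKpos : 0 < K := by positivity
  set r : ℕ → ℝ := fun k => R k - l with hr
  have hr0 : ∀ k, 0 ≤ r k := fun k => sub_nonneg.mpr (hlR k)
  have hrlim : Tendsto r atTop (𝓝 0) := by simpa using hRl.sub_const l
  have hdiff : ∀ k, r k - r (k + 1) = R k - R (k + 1) := fun k => by simp only [hr]; ring
  have hmono : ∀ k, r (k + 1) ≤ r k := fun k => by
    have := hd.antitone k.le_succ
    simp only [hr]; linarith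
  have hrec : ∀ᶠ k in atTop, dist (W (k + 1)) w < η →
      r k ^ (2 * θ') ≤ K * (r k - r (k + 1)) := by
    have hv1 : ∀ᶠ k in atTop, v (k + 1) < l + min ε 1 :=
      ((tendsto_add_atTop_iff_nat 1).mpr hvl).eventually_lt_const
        (by have := lt_min hε one_pos; linarith)
    filter_upwards [hrlim.eventually_le_const one_pos, hv1] with k hk1 hkv hkη
    obtain ⟨p, hp, -, hRp⟩ := hd.average k
    obtain ⟨D, hD1, hD2⟩ := hs k
    have hstep := rpow_le_mul_sub_of_averaged (θ := θ') (C := C') (f := v (k + 1) - l)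
      (Δ := dist (W k) (W (k + 1))) (r' := r (k + 1)) hθ'2 hθ'1 hc hpm hp (hr0 k) hk1
      (by simp only [hr]; rw [hRp]; ring)
      (by have := hd.descent k; simp only [hr]; linarith)
      (fun hpos => by
        have hmem : D + G (W (k + 1)) ∈ subdiff (fun y => h y + (f y : EReal)) (W (k + 1)) := by
          refine frechetSubdiff_subset_subdiff _ _ (hD1.add_mem_frechetSubdiff ?_ (hbot _) (hf _))
          intro htop
          have := hv (k + 1)
          rw [htop, EReal.top_add_coe] at this
          exact EReal.coe_ne_top _ this.symm
        have h1 := hKL' (W (k + 1)) (hηV hkη) (v (k + 1)) (hv (k + 1)) (by linarith)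
          (by have := min_le_left ε 1; linarith) _ hmem
        have h2 : (v (k + 1) - l) ^ θ' ≤ (v (k + 1) - l) ^ θ :=
          Real.rpow_le_rpow_of_exponent_ge hpos (by have := min_le_right ε 1; linarith)
            (le_max_left _ _)
        have h3 : 0 < 1 - θ := by linarith
        calc (v (k + 1) - l) ^ θ' ≤ a * (1 - θ) * ‖D + G (W (k + 1))‖ := h2.trans h1
          _ ≤ a * (1 - θ) * (C * dist (W k) (W (k + 1))) := by gcongr
          _ = _ := by ring)
    refine hstep.trans (mul_le_mul_of_nonneg_right ?_ (by linarith [hmono k]))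
    rw [hK]
    have : 0 < 2 / (c * pm) := by positivity
    linarith
  set φ : ℕ → ℝ := fun k => K / (1 - θ') * r k ^ (1 - θ') with hφ
  have h1θ' : 0 < 1 - θ' := by linarith
  have hφ0 : ∀ k, 0 ≤ φ k := fun k => by
    have := hr0 k
    simp only [hφ]; positivity
  have hφlim : Tendsto φ atTop (𝓝 0) := by
    have h1 := (hrlim.rpow_const (p := 1 - θ') (Or.inr h1θ'.le)).const_mul (K / (1 - θ'))
    rwa [Real.zero_rpow h1θ'.ne', mul_zero] at h1
  have hstep : ∀ᶠ k in atTop, dist (W (k + 1)) w < η →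
      dist (W k) (W (k + 1)) ≤ φ k - φ (k + 1) := by
    filter_upwards [hrec] with k hk hkη
    have h2 : dist (W k) (W (k + 1)) ^ 2 ≤ K * (r k - r (k + 1)) := by
      refine (hd.sub_le k).2.trans ?_
      rw [← hdiff]
      refine mul_le_mul_of_nonneg_right ?_ (by linarith [hmono k])
      rw [hK]
      have : 0 ≤ 8 * C' ^ 2 / (c * pm) + 2 / pm := by positivity
      linarith
    have h3 := le_mul_rpow_sub_rpow hθ'1 (by linarith) hKpos (hr0 (k + 1)) (hmono k) (hk hkη) h2
    simp only [hφ]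
    linarith
  have hW := tendsto_of_mapClusterPt_of_dist_le hη hφ0 hφlim hΔ hstep hcl
  have hnear : ∀ᶠ k in atTop, dist (W (k + 1)) w < η :=
    ((tendsto_add_atTop_iff_nat 1).mpr hW).eventually (Metric.ball_mem_nhds w hη)
  have hdist := eventually_dist_le_of_tendsto hφ0 hW
    ((hstep.and hnear).mono fun k hk => hk.1 hk.2)
  have hrec' : ∀ᶠ k in atTop, r k ^ (2 * θ') ≤ K * (r k - r (k + 1)) :=
    (hrec.and hnear).mono fun k hk => hk.1 hk.2
  refine ⟨hW, fun hθ2 => ?_, fun hθ2 => ?_⟩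
  · have hθ'eq : θ' = 1 / 2 := max_eq_right hθ2
    rw [hθ'eq] at hrec'
    obtain ⟨d, ϱ, hd0, hϱ0, hϱ1, hb⟩ := exists_geometric_bound hr0 hKpos
      (hrec'.mono fun k hk => by simpa using hk)
    refine ⟨K / (1 - θ') * d ^ (1 - θ'), ϱ ^ (1 - θ'), by positivity, by positivity,
      Real.rpow_lt_one hϱ0.le hϱ1 h1θ', ?_⟩
    filter_upwards [hdist, hb] with k hk1 hk2
    refine hk1.trans ?_
    simp only [hφ]
    rw [mul_assoc]
    refine mul_le_mul_of_nonneg_left ?_ (by positivity)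
    calc r k ^ (1 - θ') ≤ (d * ϱ ^ k) ^ (1 - θ') := Real.rpow_le_rpow (hr0 k) hk2 h1θ'.le
      _ = d ^ (1 - θ') * (ϱ ^ (1 - θ')) ^ k := by
        rw [Real.mul_rpow hd0.le (by positivity), ← Real.rpow_natCast, ← Real.rpow_natCast,
          ← Real.rpow_mul hϱ0.le, ← Real.rpow_mul hϱ0.le, mul_comm (k : ℝ)]
  · have hθ'eq : θ' = θ := max_eq_left hθ2.le
    rw [hθ'eq] at hrec' h1θ'
    have hs' : 0 < 2 * θ - 1 := by linarith
    -- With `s + 1 = 2θ`, `r` decays like `k ^ (-1 / (2θ - 1))`; the power `1 - θ` in `φ` gives the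
    -- stated exponent.
    obtain ⟨d, hd0, hb⟩ := exists_power_bound (s := 2 * θ - 1) hr0 hs' hKpos
      (hrec'.mono fun k hk => by simpa using hk)
    refine ⟨K / (1 - θ) * d ^ (1 - θ), by positivity, ?_⟩
    filter_upwards [hdist, hb] with k hk1 hk2
    refine hk1.trans ?_
    simp only [hφ, hθ'eq]
    rw [mul_assoc]
    refine mul_le_mul_of_nonneg_left ?_ (by positivity)
    calc r k ^ (1 - θ) ≤ (d * (k : ℝ) ^ (-(1 / (2 * θ - 1)))) ^ (1 - θ) :=
          Real.rpow_le_rpow (hr0 k) hk2 h1θ'.le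
      _ = d ^ (1 - θ) * (k : ℝ) ^ (-((1 - θ) / (2 * θ - 1))) := by
        rw [Real.mul_rpow hd0.le (by positivity), ← Real.rpow_mul (Nat.cast_nonneg k)]
        congr 2
        ring

end Abstract

namespace GSMF

variable {n r q : ℕ}

/-! ### The smooth part of the objective -/

theorem Assumption.mul_eq_add {P : GSMF n r q} {α β : ℝ} (hA : P.Assumption α β) :
    α * β = α + β := by
  have h := hA.inv_add_inv
  have h1 := hA.α_ne
  have h2 := hA.β_ne
  field_simp at h
  linarith

theorem Assumption.mul_div_add {P : GSMF n r q} {α β : ℝ} (hA : P.Assumption α β) :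
    α * (β / (α + β)) = 1 := by
  rw [← hA.mul_eq_add]
  have h1 := hA.α_ne
  have h2 := hA.β_ne
  field_simp

/-- `1/α + 1/β = 1` means `α β / (α + β) = 1`, which cancels the relaxation weight in `Z`. Thus the
residual of `H` at the updated `Z` is that of the original data term. -/
theorem smul_mulT_sub_zUpdate {P : GSMF n r q} {S : Params} (hA : P.Assumption S.α S.β)
    (X Y : RMat n r) : S.α • (mulT X Y - P.zUpdate S X Y) =
      ContinuousLinearMap.adjoint P.A (P.A (mulT X Y) - P.b) := by
  have h1 : mulT X Y - P.zUpdate S X Y =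
      (S.β / (S.α + S.β)) • ContinuousLinearMap.adjoint P.A (P.A (mulT X Y) - P.b) := by
    rw [zUpdate, map_sub, smul_sub]; abel
  rw [h1, smul_smul, hA.mul_div_add, one_smul]

/-- The smooth part of the objective. -/
def fit (P : GSMF n r q) (W : WithLp 2 (RMat n r × RMat n r)) : ℝ :=
  1 / 2 * ‖P.A (mulT W.fst W.snd) - P.b‖ ^ 2 + P.lam / 2 * ‖W.fst - W.snd‖ ^ 2

/-- The gradient of the smooth part, through the gradients of `H` at the updated `Z`. -/
def gradFit (P : GSMF n r q) (S : Params) (W : WithLp 2 (RMat n r × RMat n r)) :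
    WithLp 2 (RMat n r × RMat n r) :=
  WithLp.toLp 2
    (gradXH S.α W.fst W.snd (P.zUpdate S W.fst W.snd) + P.lam • (W.fst - W.snd),
      gradYH S.α W.fst W.snd (P.zUpdate S W.fst W.snd) + P.lam • (W.snd - W.fst))

theorem hasGradientAt_fit {P : GSMF n r q} {S : Params} (hA : P.Assumption S.α S.β)
    (W : WithLp 2 (RMat n r × RMat n r)) : HasGradientAt P.fit (P.gradFit S W) W := by
  have h1 : HasFDerivAt (fun W : WithLp 2 (RMat n r × RMat n r) => W.fst)
      (WithLp.fstL 2 ℝ (RMat n r) (RMat n r)) W :=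
    (WithLp.fstL 2 ℝ (RMat n r) (RMat n r)).hasFDerivAt
  have h2 : HasFDerivAt (fun W : WithLp 2 (RMat n r × RMat n r) => W.snd)
      (WithLp.sndL 2 ℝ (RMat n r) (RMat n r)) W :=
    (WithLp.sndL 2 ℝ (RMat n r) (RMat n r)).hasFDerivAt
  obtain ⟨D, h3, hD⟩ : ∃ D, HasFDerivAt
      (fun W : WithLp 2 (RMat n r × RMat n r) => mulT W.fst W.snd) D W ∧
      ∀ V, D V = mulT W.fst V.snd + mulT V.fst W.snd :=
    ⟨_, (mulTL n n r).hasFDerivAt_of_bilinear h1 h2, fun V => rfl⟩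
  have h3' : HasFDerivAt (fun W : WithLp 2 (RMat n r × RMat n r) => P.A (mulT W.fst W.snd))
      (P.A ∘L D) W := P.A.hasFDerivAt.comp W h3
  have h4 := (h3'.sub_const P.b).norm_sq.const_mul (1 / 2)
  have h5' : HasFDerivAt (fun W : WithLp 2 (RMat n r × RMat n r) => W.fst - W.snd)
      (WithLp.fstL 2 ℝ (RMat n r) (RMat n r) - WithLp.sndL 2 ℝ (RMat n r) (RMat n r)) W :=
    h1.sub h2
  have h5 := h5'.norm_sq.const_mul (P.lam / 2)
  rw [hasGradientAt_iff_hasFDerivAt]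
  refine (h4.add h5).congr_fderiv ?_
  ext V
  rw [InnerProductSpace.toDual_apply_apply, WithLp.prod_inner_apply]
  have h6 : ∀ V' : RMat n n, inner ℝ (P.A (mulT W.fst W.snd) - P.b) (P.A V') =
      S.α * inner ℝ (mulT W.fst W.snd - P.zUpdate S W.fst W.snd) V' := by
    intro V'
    rw [← real_inner_smul_left, smul_mulT_sub_zUpdate hA, ContinuousLinearMap.adjoint_inner_left]
  simp only [gradFit]
  change _ = inner ℝ (gradXH S.α W.fst W.snd (P.zUpdate S W.fst W.snd)
      + P.lam • (W.fst - W.snd)) V.fst + inner ℝ (gradYH S.α W.fst W.snd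
        (P.zUpdate S W.fst W.snd) + P.lam • (W.snd - W.fst)) V.snd
  rw [inner_add_left, inner_add_left, inner_gradXH, inner_gradYH, real_inner_smul_left,
    real_inner_smul_left]
  simp only [add_apply, smul_apply, sub_apply, ContinuousLinearMap.comp_apply, hD,
    innerSL_apply_apply, smul_eq_mul, nsmul_eq_mul, WithLp.fstL_apply, WithLp.sndL_apply, h6,
    inner_add_right]
  have h7 : inner ℝ (W.snd - W.fst) V.snd = - inner ℝ (W.fst - W.snd) V.snd := by
    rw [← inner_neg_left, neg_sub]
  rw [h7, inner_sub_right]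
  push_cast
  ring

section Smoothness

variable {E : Type*} [NormedAddCommGroup E] [NormedSpace ℝ E] {f g : E → RMat n r}
  {h : E → RMat n n}

theorem contDiff_mulT (hf : ContDiff ℝ 1 f) (hg : ContDiff ℝ 1 g) :
    ContDiff ℝ 1 fun x => mulT (f x) (g x) := by
  simp only [← mulTL_apply]
  fun_prop

theorem contDiff_zUpdate (P : GSMF n r q) (S : Params) (hf : ContDiff ℝ 1 f)
    (hg : ContDiff ℝ 1 g) : ContDiff ℝ 1 fun x => P.zUpdate S (f x) (g x) := by
  have h := contDiff_mulT hf hg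
  unfold zUpdate
  fun_prop

theorem contDiff_gradXH (α : ℝ) (hf : ContDiff ℝ 1 f) (hg : ContDiff ℝ 1 g)
    (hh : ContDiff ℝ 1 h) : ContDiff ℝ 1 fun x => gradXH α (f x) (g x) (h x) := by
  rw [contDiff_euclidean]
  rintro ⟨i, j⟩
  simp only [gradXH, ofM, toM, Matrix.mul_apply, Matrix.of_apply, PiLp.smul_apply,
    PiLp.sub_apply, mulT_apply]
  fun_prop

theorem contDiff_gradYH (α : ℝ) (hf : ContDiff ℝ 1 f) (hg : ContDiff ℝ 1 g)
    (hh : ContDiff ℝ 1 h) : ContDiff ℝ 1 fun x => gradYH α (f x) (g x) (h x) := by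
  rw [contDiff_euclidean]
  rintro ⟨i, j⟩
  simp only [gradYH, ofM, toM, Matrix.mul_apply, Matrix.of_apply, PiLp.smul_apply,
    PiLp.sub_apply, mulT_apply, Matrix.transpose_apply]
  fun_prop

end Smoothness

theorem continuous_gradFit (P : GSMF n r q) (S : Params) : Continuous (P.gradFit S) := by
  have h1 : ContDiff ℝ 1 fun W : WithLp 2 (RMat n r × RMat n r) => W.fst :=
    (WithLp.fstL 2 ℝ (RMat n r) (RMat n r)).contDiff
  have h2 : ContDiff ℝ 1 fun W : WithLp 2 (RMat n r × RMat n r) => W.snd :=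
    (WithLp.sndL 2 ℝ (RMat n r) (RMat n r)).contDiff
  have hz := contDiff_zUpdate P S h1 h2
  exact (WithLp.prod_continuous_toLp 2 _ _).comp
    (((contDiff_gradXH S.α h1 h2 hz).add ((h1.sub h2).const_smul P.lam)).continuous.prodMk
      ((contDiff_gradYH S.α h1 h2 hz).add ((h2.sub h1).const_smul P.lam)).continuous)

theorem contDiff_gradXH_zUpdate (P : GSMF n r q) (S : Params) :
    ContDiff ℝ 1 fun p : RMat n r × RMat n r × RMat n r =>
      gradXH S.α p.1 p.2.1 (P.zUpdate S p.1 p.2.1) :=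
  contDiff_gradXH S.α contDiff_fst contDiff_snd.fst
    (contDiff_zUpdate P S contDiff_fst contDiff_snd.fst)

/-- The third slot holds the new left factor while `Z` is built from the first two: `(X, Y, U)`
gives the lagged gradient seen by the `Y`-update, and `(U, V, U)` the gradient at the new pair. -/
theorem contDiff_gradYH_zUpdate (P : GSMF n r q) (S : Params) :
    ContDiff ℝ 1 fun p : RMat n r × RMat n r × RMat n r =>
      gradYH S.α p.2.2 p.2.1 (P.zUpdate S p.1 p.2.1) :=
  contDiff_gradYH S.α contDiff_snd.snd contDiff_snd.fst
    (contDiff_zUpdate P S contDiff_fst contDiff_snd.fst)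

/-- Local Lipschitz estimates for the partial gradients with lagged arguments. -/
theorem exists_lipschitz_grad (P : GSMF n r q) (S : Params) (M : ℝ) :
    ∃ K : ℝ, 0 ≤ K ∧ ∀ X Y U V : RMat n r, ‖X‖ ≤ M → ‖Y‖ ≤ M → ‖U‖ ≤ M → ‖V‖ ≤ M →
      ‖gradXH S.α U V (P.zUpdate S U V) - gradXH S.α X Y (P.zUpdate S X Y)‖
          ≤ K * (‖U - X‖ + ‖V - Y‖) ∧
      ‖gradYH S.α U V (P.zUpdate S U V) - gradYH S.α U Y (P.zUpdate S X Y)‖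
          ≤ K * (‖U - X‖ + ‖V - Y‖) := by
  set B := Metric.closedBall (0 : RMat n r × RMat n r × RMat n r) M with hB
  obtain ⟨K1, hK1⟩ := (contDiff_gradXH_zUpdate P S).contDiffOn.exists_lipschitzOnWith one_ne_zero
    (convex_closedBall (0 : RMat n r × RMat n r × RMat n r) M) (isCompact_closedBall _ _)
  obtain ⟨K2, hK2⟩ := (contDiff_gradYH_zUpdate P S).contDiffOn.exists_lipschitzOnWith one_ne_zero
    (convex_closedBall (0 : RMat n r × RMat n r × RMat n r) M) (isCompact_closedBall _ _)
  refine ⟨K1 + K2, by positivity, fun X Y U V hXM hYM hUM hVM => ?_⟩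
  have hmem : ∀ a b : RMat n r, ‖a‖ ≤ M → ‖b‖ ≤ M → (a, b, U) ∈ B := by
    intro a b ha hb
    rw [hB, mem_closedBall_zero_iff]
    exact max_le ha (max_le hb hUM)
  have hnorm : dist (U, V, U) (X, Y, U) ≤ ‖U - X‖ + ‖V - Y‖ := by
    rw [dist_eq_norm]
    refine max_le ?_ (max_le ?_ ?_)
    · exact le_add_of_nonneg_right (norm_nonneg _)
    · exact le_add_of_nonneg_left (norm_nonneg _)
    · simp only [Prod.snd_sub, sub_self, norm_zero]; positivity
  have h1 := hK1.dist_le_mul _ (hmem U V hUM hVM) _ (hmem X Y hXM hYM)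
  have h2 := hK2.dist_le_mul _ (hmem U V hUM hVM) _ (hmem X Y hXM hYM)
  rw [dist_eq_norm] at h1 h2
  constructor
  · refine h1.trans (mul_le_mul ?_ hnorm dist_nonneg (by positivity))
    exact le_add_of_nonneg_right K2.coe_nonneg
  · refine h2.trans (mul_le_mul ?_ hnorm dist_nonneg (by positivity))
    exact le_add_of_nonneg_left K1.coe_nonneg

/-! ### The proximal parameters of the inner loop -/

/-- Only `α < 0` is at stake. If `A` has a kernel, a kernel vector shows `α + γ ≥ 0` and is fixed by
the operator in `ρ`, so `ρ ≥ 1`. Otherwise `A A* = I` forces `A* A = I`, that operator is the scalar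
`s = 1 - 1/α`, and positivity gives `γ ≥ -(α + β)`; hence `γ ρ ≥ -(α + β) s ^ 2 = -α s = 1 - α`. -/
theorem add_two_mul_rho_nonneg {P : GSMF n r q} {S : Params} (hA : P.Assumption S.α S.β)
    (hS : S.Admissible P) [Nontrivial (RMat n n)] : 0 ≤ S.α + 2 * S.γ * P.rho S := by
  have hγ := hS.γ_nonneg
  have hρ : 0 ≤ P.rho S := sq_nonneg _
  rcases le_or_gt 0 S.α with hα | hα
  · positivity
  have hab := hA.mul_eq_add
  have hmd := hA.mul_div_add
  set T := ContinuousLinearMap.id ℝ (RMat n n) -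
    (S.β / (S.α + S.β)) • (ContinuousLinearMap.adjoint P.A ∘L P.A) with hT
  have hrho : P.rho S = ‖T‖ ^ 2 := rfl
  have hpos : ∀ M : RMat n n, 0 ≤ (S.α + S.γ) * ‖M‖ ^ 2 + S.β * ‖P.A M‖ ^ 2 := by
    intro M
    have h := hS.γ_psd.inner_nonneg_left M
    simp only [add_apply, smul_apply,
      ContinuousLinearMap.comp_apply, ContinuousLinearMap.id_apply, inner_add_left,
      real_inner_smul_left, ContinuousLinearMap.adjoint_inner_left,
      real_inner_self_eq_norm_sq] at h
    exact h
  by_cases hker : ∃ M : RMat n n, M ≠ 0 ∧ P.A M = 0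
  · obtain ⟨M, hM, hAM⟩ := hker
    have hMn : 0 < ‖M‖ := norm_pos_iff.mpr hM
    have h1 := hpos M
    have h2 : 0 ≤ S.α + S.γ := by
      rw [hAM, norm_zero] at h1
      have : 0 < ‖M‖ ^ 2 := by positivity
      by_contra! hneg
      nlinarith
    have h3 : T M = M := by simp [hT, hAM]
    have h4 : 1 ≤ ‖T‖ := by
      have := T.le_opNorm M
      rw [h3] at this
      exact le_of_mul_le_mul_right (by linarith) hMn
    have h5 : 1 ≤ P.rho S := by rw [hrho]; nlinarith
    nlinarith
  · push Not at hker
    have hinj : ∀ M : RMat n n, ContinuousLinearMap.adjoint P.A (P.A M) = M := by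
      intro M
      have h1 : P.A (ContinuousLinearMap.adjoint P.A (P.A M) - M) = 0 := by
        have := DFunLike.congr_fun hA.coisometry (P.A M)
        simp only [ContinuousLinearMap.comp_apply, ContinuousLinearMap.id_apply] at this
        rw [map_sub, this, sub_self]
      by_contra hne
      exact hker _ (sub_ne_zero.mpr hne) h1
    obtain ⟨M, hM⟩ := exists_ne (0 : RMat n n)
    have hMn : 0 < ‖M‖ := norm_pos_iff.mpr hM
    have hAM : ‖P.A M‖ ^ 2 = ‖M‖ ^ 2 := by
      rw [← real_inner_self_eq_norm_sq, ← ContinuousLinearMap.adjoint_inner_left, hinj,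
        real_inner_self_eq_norm_sq]
    have h1 := hpos M
    rw [hAM] at h1
    have h2 : 0 ≤ S.α + S.γ + S.β := by
      have : 0 < ‖M‖ ^ 2 := by positivity
      by_contra! hneg
      nlinarith
    set s := 1 - S.β / (S.α + S.β) with hs
    have h3 : T M = s • M := by simp [hT, hinj, hs, sub_smul]
    have h4 : |s| ≤ ‖T‖ := by
      have := T.le_opNorm M
      rw [h3, norm_smul, Real.norm_eq_abs] at this
      exact le_of_mul_le_mul_right this hMn
    have h5 : s ^ 2 ≤ P.rho S := by
      rw [hrho, ← sq_abs]; exact pow_le_pow_left₀ (abs_nonneg _) h4 2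
    have h6 : S.α * s = S.α - 1 := by rw [hs]; linarith
    have h7 : S.α - 1 < 0 := by linarith
    have h12 : -(S.α + S.β) * s = -S.α := by
      have : S.α + S.β ≠ 0 := by rw [← hab]; exact mul_ne_zero hA.α_ne hA.β_ne
      rw [hs]; field_simp; ring
    have h13 : -(S.α + S.β) * s ^ 2 = -S.α * s := by rw [sq, ← mul_assoc, h12]
    have h14 : -(S.α + S.β) * s ^ 2 ≤ S.γ * P.rho S := by
      calc -(S.α + S.β) * s ^ 2 ≤ S.γ * s ^ 2 :=
            mul_le_mul_of_nonneg_right (by linarith) (sq_nonneg _)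
        _ ≤ _ := mul_le_mul_of_nonneg_left h5 hγ
    nlinarith

theorem cap_pos {P : GSMF n r q} {S : Params} (hA : P.Assumption S.α S.β)
    (hS : S.Admissible P) (Y : RMat n r) : 0 < P.cap S Y := by
  have hc := hS.c_pos
  rcases isEmpty_or_nonempty (Fin n) with h | h
  · have hY : specNorm Y = 0 := by
      obtain ⟨C, -, hC⟩ := exists_specNorm_le n r
      have h1 : Y = 0 := Subsingleton.elim _ _
      have h2 := hC Y
      rw [h1, norm_zero, mul_zero] at h2
      rw [h1]
      exact le_antisymm h2 (specNorm_nonneg _)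
    simpa [cap, hY] using hc
  · have := add_two_mul_rho_nonneg hA hS
    have h2 : 0 ≤ specNorm Y := specNorm_nonneg Y
    unfold cap
    positivity

/-- Loop invariant. While `μ` is below its cap both parameters grow by the same factor, so `σ / μ ≤
σmax / μmin`. Truncating `μ` at the cap can cost one more factor `τ` in `σ`; afterwards `σ` is
limited by the cap at `U`. -/
theorem InnerReach.bounds {P : GSMF n r q} {S : Params} (hA : P.Assumption S.α S.β)
    (hS : S.Admissible P) {X Y : RMat n r} {R μ₀ σ₀ μ σ : ℝ} {U V : RMat n r}
    (h : InnerReach P S X Y R μ₀ σ₀ μ σ U V) (hμ₀ : S.μmin ≤ μ₀) (hσ₀ : S.σmin ≤ σ₀)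
    (hσ₀' : σ₀ ≤ S.σmax) :
    P.XUpdate S.α X Y (P.zUpdate S X Y) μ U ∧ P.YUpdate S.α U Y (P.zUpdate S X Y) σ V ∧ 0 < σ ∧
      (μ = P.cap S Y ∧ σ ≤ S.σmax + S.τ * S.σmax * P.cap S Y / S.μmin + P.cap S U ∨
        S.μmin ≤ μ ∧ μ < P.cap S Y ∧ σ * S.μmin ≤ S.σmax * μ) := by
  have hμm := hS.μmin_pos
  have hσm := hS.σmin_pos
  have hτ := hS.τ_gt
  have hcap := cap_pos hA hS Y
  have hσM : 0 < S.σmax := hσm.trans hS.σmin_lt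
  have hB : 0 ≤ S.τ * S.σmax * P.cap S Y / S.μmin := by positivity
  induction h with
  | start U V hU hV =>
    refine ⟨hU, hV, hσm.trans_le hσ₀, ?_⟩
    rcases lt_or_ge μ₀ (P.cap S Y) with h | h
    · rw [min_eq_left h.le]
      right
      exact ⟨hμ₀, h, mul_le_mul hσ₀' hμ₀ hμm.le hσM.le⟩
    · rw [min_eq_right h]
      left
      refine ⟨rfl, ?_⟩
      have := cap_pos hA hS U
      linarith
  | raiseBoth μ σ U V U' V' hprev hfail hμ hU hV ih =>
    obtain ⟨-, -, hσ, ih⟩ := ih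
    obtain ⟨h1, h2, h3⟩ := ih.resolve_left fun h => hμ h.1
    refine ⟨hU, hV, by positivity, ?_⟩
    rcases lt_or_ge (S.τ * μ) (P.cap S Y) with h | h
    · rw [min_eq_left h.le]
      right
      refine ⟨h1.trans (le_mul_of_one_le_left (hμm.le.trans h1) hτ.le), h, ?_⟩
      calc S.τ * σ * S.μmin = S.τ * (σ * S.μmin) := by ring
        _ ≤ S.τ * (S.σmax * μ) := by gcongr
        _ = _ := by ring
    · rw [min_eq_right h]
      left
      refine ⟨rfl, ?_⟩
      have h4 : S.τ * σ ≤ S.τ * S.σmax * P.cap S Y / S.μmin := by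
        rw [le_div_iff₀ hμm]
        calc S.τ * σ * S.μmin = S.τ * (σ * S.μmin) := by ring
          _ ≤ S.τ * (S.σmax * P.cap S Y) := by
            refine mul_le_mul_of_nonneg_left (h3.trans ?_) (by positivity)
            gcongr
          _ = _ := by ring
      have := cap_pos hA hS U'
      linarith
  | raiseSigma μ σ U V V' hprev hfail hμ hV ih =>
    obtain ⟨hU, -, hσ, -⟩ := ih
    refine ⟨hU, hV, lt_min (by positivity) (cap_pos hA hS U), Or.inl ⟨hμ, ?_⟩⟩
    have := min_le_right (S.τ * σ) (P.cap S U)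
    linarith

/-- On bounded sets the inner loop uses bounded proximal parameters. -/
theorem exists_param_bound {P : GSMF n r q} {S : Params} (hA : P.Assumption S.α S.β)
    (hS : S.Admissible P) (M : ℝ) :
    ∃ L : ℝ, 0 ≤ L ∧ ∀ (X Y U V : RMat n r) (R μ₀ σ₀ μ σ : ℝ), ‖Y‖ ≤ M → ‖U‖ ≤ M →
      InnerReach P S X Y R μ₀ σ₀ μ σ U V → S.μmin ≤ μ₀ → S.σmin ≤ σ₀ → σ₀ ≤ S.σmax →
      P.XUpdate S.α X Y (P.zUpdate S X Y) μ U ∧ P.YUpdate S.α U Y (P.zUpdate S X Y) σ V ∧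
        |μ| ≤ L ∧ |σ| ≤ L := by
  obtain ⟨C, hC0, hC⟩ := exists_specNorm_le n r
  set N := |S.α + 2 * S.γ * P.rho S| * (C * M) ^ 2 + S.c with hN
  have hc := hS.c_pos
  have hμm := hS.μmin_pos
  have hσM : 0 < S.σmax := hS.σmin_pos.trans hS.σmin_lt
  have hτ : 0 < S.τ := one_pos.trans hS.τ_gt
  have hN0 : 0 < N := by positivity
  have hcapN : ∀ Y : RMat n r, ‖Y‖ ≤ M → P.cap S Y ≤ N := by
    intro Y hY
    have h1 : specNorm Y ≤ C * M := (hC Y).trans (by gcongr)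
    have h2 : specNorm Y ^ 2 ≤ (C * M) ^ 2 := pow_le_pow_left₀ (specNorm_nonneg Y) h1 2
    unfold cap
    rw [hN]
    have h3 : (S.α + 2 * S.γ * P.rho S) * specNorm Y ^ 2 ≤
        |S.α + 2 * S.γ * P.rho S| * (C * M) ^ 2 := by
      calc _ ≤ |S.α + 2 * S.γ * P.rho S| * specNorm Y ^ 2 := by gcongr; exact le_abs_self _
        _ ≤ _ := by gcongr
    linarith
  refine ⟨S.σmax + S.τ * S.σmax * N / S.μmin + N + S.σmax * N / S.μmin, by positivity, ?_⟩
  intro X Y U V R μ₀ σ₀ μ σ hY hU h hμ₀ hσ₀ hσ₀'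
  obtain ⟨h1, h2, h3, h4⟩ := h.bounds hA hS hμ₀ hσ₀ hσ₀'
  have hcY := hcapN Y hY
  have hcU := hcapN U hU
  have hcYp := cap_pos hA hS Y
  have hp1 : 0 < S.τ * S.σmax * N / S.μmin := by positivity
  have hp2 : 0 < S.σmax * N / S.μmin := by positivity
  refine ⟨h1, h2, ?_⟩
  rw [abs_of_pos h3]
  rcases h4 with ⟨h5, h6⟩ | ⟨h5, h6, h7⟩
  · have h8 : S.τ * S.σmax * P.cap S Y / S.μmin ≤ S.τ * S.σmax * N / S.μmin := by gcongr
    rw [h5, abs_of_pos hcYp]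
    constructor <;> linarith
  · have h8 : σ ≤ S.σmax * N / S.μmin := by
      rw [le_div_iff₀ hμm]
      exact h7.trans (by gcongr; linarith)
    rw [abs_of_pos (hμm.trans_le h5)]
    constructor <;> linarith

end GSMF

/-! ### The abstract theorem applied to runs of the algorithm -/

namespace GSMF

variable {n r q : ℕ} {P : GSMF n r q} {S : Params}

/-- The nonsmooth part of the objective. -/
def nonsmooth (P : GSMF n r q) (W : WithLp 2 (RMat n r × RMat n r)) : EReal :=
  P.Ψ W.fst + P.Φ W.snd

theorem objectivePair_eq (P : GSMF n r q) :
    P.objectivePair = fun W => P.nonsmooth W + (P.fit W : EReal) := rfl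

theorem Assumption.nonsmooth_ne_bot {α β : ℝ} (hA : P.Assumption α β)
    (W : WithLp 2 (RMat n r × RMat n r)) : P.nonsmooth W ≠ ⊥ := by
  simp [nonsmooth, EReal.add_eq_bot_iff, hA.Ψ_proper.ne_bot, hA.Φ_proper.ne_bot]

theorem Assumption.lowerSemicontinuous_nonsmooth {α β : ℝ} (hA : P.Assumption α β) :
    LowerSemicontinuous P.nonsmooth := by
  refine LowerSemicontinuous.add'
    (hA.Ψ_proper.lsc.comp (WithLp.fstL 2 ℝ (RMat n r) (RMat n r)).continuous)
    (hA.Φ_proper.lsc.comp (WithLp.sndL 2 ℝ (RMat n r) (RMat n r)).continuous) fun W => ?_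
  exact EReal.continuousAt_add (Or.inr (hA.Φ_proper.ne_bot _)) (Or.inl (hA.Ψ_proper.ne_bot _))

theorem Assumption.exists_le_objective {α β : ℝ} (hA : P.Assumption α β) :
    ∃ m : ℝ, ∀ X Y, (m : EReal) ≤ P.objective X Y := by
  obtain ⟨m₁, h₁⟩ := hA.Ψ_bdd
  obtain ⟨m₂, h₂⟩ := hA.Φ_bdd
  refine ⟨m₁ + m₂ + 0, fun X Y => ?_⟩
  have hlam := hA.lam_nonneg
  rw [EReal.coe_add, EReal.coe_add]
  refine add_le_add (add_le_add (h₁ X) (h₂ Y)) (EReal.coe_le_coe_iff.2 ?_)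
  positivity

theorem dist_toLp_sq (X Y U V : RMat n r) :
    dist (WithLp.toLp 2 (X, Y)) (WithLp.toLp 2 (U, V)) ^ 2 = ‖U - X‖ ^ 2 + ‖V - Y‖ ^ 2 := by
  rw [dist_comm, dist_eq_norm, WithLp.prod_norm_sq_eq_of_L2]
  rfl

theorem IsRun.objective_eq_coe {X Y : ℕ → RMat n r} {R : ℕ → ℝ} (hrun : P.IsRun S X Y R)
    (hA : P.Assumption S.α S.β) (k : ℕ) :
    P.objective (X k) (Y k) = ((P.objective (X k) (Y k)).toReal : EReal) := by
  refine (EReal.coe_toReal ?_ ?_).symm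
  · cases k with
    | zero => exact hrun.init_dom
    | succ k =>
      obtain ⟨_, _, _, _, _, _, _, _, h⟩ := hrun.step k
      exact ne_top_of_le_ne_top (EReal.coe_ne_top _) h
  · obtain ⟨m, hm⟩ := hA.exists_le_objective
    exact ne_bot_of_le_ne_bot (EReal.coe_ne_bot m) (hm _ _)

theorem IsRun.exists_averagedDescent {X Y : ℕ → RMat n r} {R : ℕ → ℝ} (hrun : P.IsRun S X Y R)
    (hA : P.Assumption S.α S.β) (hS : S.Admissible P) :
    ∃ m, AveragedDescent (fun k => WithLp.toLp 2 (X k, Y k))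
      (fun k => (P.objective (X k) (Y k)).toReal) R S.c S.pmin m := by
  obtain ⟨m, hm⟩ := hA.exists_le_objective
  refine ⟨m, hS.c_pos, hS.pmin_pos, hrun.init_ref, fun k => ?_, fun k => ?_, hrun.ref⟩
  · have := hm (X k) (Y k)
    rw [hrun.objective_eq_coe hA k] at this
    exact_mod_cast this
  · obtain ⟨_, _, _, _, _, _, _, _, h⟩ := hrun.step k
    rw [Accepts, hrun.objective_eq_coe hA (k + 1), EReal.coe_le_coe_iff] at h
    rw [dist_toLp_sq]
    exact h

/-- Along a bounded run the nonsmooth part has uniform quadratic supports that are stationary up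
to a multiple of the step length. -/
theorem IsRun.exists_hasQuadraticSupport {X Y : ℕ → RMat n r} {R : ℕ → ℝ}
    (hrun : P.IsRun S X Y R) (hA : P.Assumption S.α S.β) (hS : S.Admissible P) {M : ℝ}
    (hX : ∀ k, ‖X k‖ ≤ M) (hY : ∀ k, ‖Y k‖ ≤ M) :
    ∃ L C : ℝ, ∀ k, ∃ D,
      HasQuadraticSupport P.nonsmooth (WithLp.toLp 2 (X (k + 1), Y (k + 1))) D L ∧
      ‖D + P.gradFit S (WithLp.toLp 2 (X (k + 1), Y (k + 1)))‖ ≤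
        C * dist (WithLp.toLp 2 (X k, Y k)) (WithLp.toLp 2 (X (k + 1), Y (k + 1))) := by
  obtain ⟨L₀, hL₀, hpar⟩ := exists_param_bound hA hS M
  obtain ⟨K, hK, hlip⟩ := exists_lipschitz_grad P S M
  set L := |S.α| * (‖mulTL n n r‖ * M) ^ 2 + |P.lam| + L₀ with hL
  have hL0 : 0 ≤ L := by positivity
  refine ⟨L, 2 * ((r + 1) * L) + 4 * K + 3 * |P.lam|, fun k => ?_⟩
  obtain ⟨μ₀, σ₀, μ, σ, hμ₀, hσ₀, hσ₀', hreach, -⟩ := hrun.step k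
  obtain ⟨hU, hV, hμ, hσ⟩ := hpar _ _ _ _ _ _ _ _ _ (hY k) (hX (k + 1)) hreach hμ₀ hσ₀ hσ₀'
  have hbound : ∀ (T : RMat n r) (t : ℝ), ‖T‖ ≤ M → |t| ≤ L₀ →
      |S.α| * (‖mulTL n n r‖ * ‖T‖) ^ 2 + |P.lam| + |t| ≤ L := fun T t hT ht => by
    rw [hL]; gcongr
  obtain ⟨D₁, hD₁, hD₁'⟩ := hU.exists_hasQuadraticSupport (hbound _ _ (hY k) hμ)
  obtain ⟨D₂, hD₂, hD₂'⟩ := hV.exists_hasQuadraticSupport (hbound _ _ (hX (k + 1)) hσ)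
  obtain ⟨hl₁, hl₂⟩ := hlip _ _ _ _ (hX k) (hY k) (hX (k + 1)) (hY (k + 1))
  set U := X (k + 1)
  set V := Y (k + 1)
  set Δ := dist (WithLp.toLp 2 (X k, Y k)) (WithLp.toLp 2 (U, V)) with hΔ
  have hsq : Δ ^ 2 = ‖U - X k‖ ^ 2 + ‖V - Y k‖ ^ 2 := dist_toLp_sq _ _ _ _
  have hΔ0 : 0 ≤ Δ := dist_nonneg
  have hdX : ‖U - X k‖ ≤ Δ := le_of_sq_le_sq (by rw [hsq]; linarith [sq_nonneg ‖V - Y k‖]) hΔ0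
  have hdY : ‖V - Y k‖ ≤ Δ := le_of_sq_le_sq (by rw [hsq]; linarith [sq_nonneg ‖U - X k‖]) hΔ0
  refine ⟨WithLp.toLp 2 (D₁, D₂), hD₁.prod hD₂, ?_⟩
  -- The slopes are controlled against lagged gradients, at `(X k, Y k)` and `(U, Y k)`; both are
  -- moved to the new pair. In the coupling term both factors move for `X`, only one for `Y`, giving
  -- the total `3 * |P.lam|`.
  have e₁ : D₁ + (gradXH S.α U V (P.zUpdate S U V) + P.lam • (U - V)) =
      (D₁ + gradXH S.α (X k) (Y k) (P.zUpdate S (X k) (Y k)) + P.lam • (X k - Y k)) +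
      (gradXH S.α U V (P.zUpdate S U V) - gradXH S.α (X k) (Y k) (P.zUpdate S (X k) (Y k))) +
      (P.lam • (U - X k) - P.lam • (V - Y k)) := by module
  have e₂ : D₂ + (gradYH S.α U V (P.zUpdate S U V) + P.lam • (V - U)) =
      (D₂ + gradYH S.α U (Y k) (P.zUpdate S (X k) (Y k)) + P.lam • (Y k - U)) +
      (gradYH S.α U V (P.zUpdate S U V) - gradYH S.α U (Y k) (P.zUpdate S (X k) (Y k))) +
      P.lam • (V - Y k) := by module
  have hlipΔ : K * (‖U - X k‖ + ‖V - Y k‖) ≤ 2 * K * Δ := by nlinarith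
  have hsm : ∀ T : RMat n r, ‖T‖ ≤ Δ → ‖P.lam • T‖ ≤ |P.lam| * Δ := fun T hT => by
    rw [norm_smul, Real.norm_eq_abs]; gcongr
  have b₁ : ‖D₁ + (gradXH S.α U V (P.zUpdate S U V) + P.lam • (U - V))‖ ≤
      (r + 1) * L * Δ + 2 * K * Δ + 2 * |P.lam| * Δ := by
    rw [e₁]
    refine norm_add₃_le.trans (add_le_add (add_le_add (hD₁'.trans (by gcongr))
      (hl₁.trans hlipΔ)) ((norm_sub_le _ _).trans ?_))
    linarith [hsm _ hdX, hsm _ hdY]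
  have b₂ : ‖D₂ + (gradYH S.α U V (P.zUpdate S U V) + P.lam • (V - U))‖ ≤
      (r + 1) * L * Δ + 2 * K * Δ + |P.lam| * Δ := by
    rw [e₂]
    exact norm_add₃_le.trans (add_le_add (add_le_add (hD₂'.trans (by gcongr))
      (hl₂.trans hlipΔ)) (hsm _ hdY))
  have hsum : ∀ W : WithLp 2 (RMat n r × RMat n r), ‖W‖ ≤ ‖W.fst‖ + ‖W.snd‖ := fun W => by
    refine le_of_sq_le_sq ?_ (by positivity)
    rw [WithLp.prod_norm_sq_eq_of_L2]
    nlinarith [norm_nonneg W.fst, norm_nonneg W.snd]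
  refine (hsum _).trans ((add_le_add b₁ b₂).trans (le_of_eq ?_))
  ring

/-- Boundedness of the run is what makes the parameter bounds and Lipschitz constants uniform. It is
a hypothesis here because it has two sources: level-boundedness, or convergence itself. -/
theorem IsRun.tendsto_and_rate {X Y : ℕ → RMat n r} {R : ℕ → ℝ} (hrun : P.IsRun S X Y R)
    (hA : P.Assumption S.α S.β) (hS : S.Admissible P) {θ : ℝ} (hθ1 : θ < 1)
    (hKL : IsKLWithExponent P.objectivePair θ)
    (hb : Bornology.IsBounded (Set.range fun k => WithLp.toLp 2 (X k, Y k)))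
    {w : WithLp 2 (RMat n r × RMat n r)}
    (hcl : MapClusterPt w atTop fun k => WithLp.toLp 2 (X k, Y k)) :
    Tendsto (fun k => WithLp.toLp 2 (X k, Y k)) atTop (𝓝 w) ∧
    (θ ≤ 1 / 2 → ∃ d ϱ : ℝ, 0 < d ∧ 0 < ϱ ∧ ϱ < 1 ∧
      ∀ᶠ k : ℕ in atTop, dist (WithLp.toLp 2 (X k, Y k)) w ≤ d * ϱ ^ k) ∧
    (1 / 2 < θ → ∃ d : ℝ, 0 < d ∧ ∀ᶠ k : ℕ in atTop,
      dist (WithLp.toLp 2 (X k, Y k)) w ≤ d * (k : ℝ) ^ (-((1 - θ) / (2 * θ - 1)))) := by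
  obtain ⟨M, hM⟩ := hb.exists_norm_le
  have hX : ∀ k, ‖X k‖ ≤ M := fun k =>
    (WithLp.norm_fst_le _ (WithLp.toLp 2 (X k, Y k))).trans (hM _ ⟨k, rfl⟩)
  have hY : ∀ k, ‖Y k‖ ≤ M := fun k =>
    (WithLp.norm_snd_le _ (WithLp.toLp 2 (X k, Y k))).trans (hM _ ⟨k, rfl⟩)
  obtain ⟨m, hd⟩ := hrun.exists_averagedDescent hA hS
  obtain ⟨L, C, hs⟩ := hrun.exists_hasQuadraticSupport hA hS hX hY
  rw [objectivePair_eq] at hKL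
  exact hd.tendsto_and_rate hA.lowerSemicontinuous_nonsmooth hA.nonsmooth_ne_bot
    (hasGradientAt_fit hA) (continuous_gradFit P S) (fun k => hrun.objective_eq_coe hA k) hs
    hθ1 hKL hcl

end GSMF

end

/-! ### Main theorem -/

theorem theorem5p4 {n r q : ℕ} (P : GSMF n r q) (S : GSMF.Params)
    (hA : P.Assumption S.α S.β) (hS : S.Admissible P)
    (θ : ℝ) (hθ0 : 0 ≤ θ) (hθ1 : θ < 1)
    (hKL : Variational.IsKLWithExponent P.objectivePair θ)
    (X Y : ℕ → RMat n r) (R : ℕ → ℝ) (hrun : P.IsRun S X Y R) :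
    (Variational.IsLevelBounded P.objectivePair →
      ∃ Xt Yt : RMat n r, Tendsto X atTop (𝓝 Xt) ∧ Tendsto Y atTop (𝓝 Yt)) ∧
    ∀ Xt Yt : RMat n r, Tendsto X atTop (𝓝 Xt) → Tendsto Y atTop (𝓝 Yt) →
      (θ ≤ 1 / 2 → ∃ d₁ ϱ : ℝ, 0 < d₁ ∧ 0 < ϱ ∧ ϱ < 1 ∧
        ∀ᶠ k : ℕ in atTop, ‖X k - Xt‖ + ‖Y k - Yt‖ ≤ d₁ * ϱ ^ k) ∧
      (1 / 2 < θ → ∃ d₂ : ℝ, 0 < d₂ ∧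
        ∀ᶠ k : ℕ in atTop,
          ‖X k - Xt‖ + ‖Y k - Yt‖ ≤ d₂ * (k : ℝ) ^ (-((1 - θ) / (2 * θ - 1)))) := by
  refine ⟨fun hlev => ?_, fun Xt Yt hXt hYt => ?_⟩
  · obtain ⟨m, hd⟩ := hrun.exists_averagedDescent hA hS
    -- Although the objective is not monotone along the run, it stays below the decreasing
    -- references, hence below `R 0`.
    have hmem : ∀ k, (WithLp.toLp 2 (X k, Y k)) ∈ {W | P.objectivePair W ≤ (R 0 : EReal)} := by
      intro k
      change P.objective (X k) (Y k) ≤ _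
      rw [hrun.objective_eq_coe hA k, EReal.coe_le_coe_iff]
      exact (hd.le_ref k).trans (hd.antitone (Nat.zero_le k))
    obtain ⟨w, -, φ, hφ, hφw⟩ := tendsto_subseq_of_bounded (hlev (R 0)) hmem
    have hcl : MapClusterPt w atTop fun k => WithLp.toLp 2 (X k, Y k) :=
      MapClusterPt.of_comp hφ.tendsto_atTop hφw.mapClusterPt
    have hlim := (hrun.tendsto_and_rate hA hS hθ1 hKL
      ((hlev (R 0)).subset (Set.range_subset_iff.mpr hmem)) hcl).1
    exact ⟨w.fst, w.snd,
      ((WithLp.fstL 2 ℝ (RMat n r) (RMat n r)).continuous.tendsto w).comp hlim,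
      ((WithLp.sndL 2 ℝ (RMat n r) (RMat n r)).continuous.tendsto w).comp hlim⟩
  -- A convergent run is bounded with its limit as cluster point, so the rates need no
  -- level-boundedness.
  · have hlim : Tendsto (fun k => WithLp.toLp 2 (X k, Y k)) atTop (𝓝 (WithLp.toLp 2 (Xt, Yt))) :=
      ((WithLp.prod_continuous_toLp 2 _ _).tendsto _).comp (hXt.prodMk_nhds hYt)
    obtain ⟨-, h1, h2⟩ := hrun.tendsto_and_rate hA hS hθ1 hKL
      (Metric.isBounded_range_of_tendsto _ hlim) hlim.mapClusterPt
    have hle : ∀ k, ‖X k - Xt‖ + ‖Y k - Yt‖ ≤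
        2 * dist (WithLp.toLp 2 (X k, Y k)) (WithLp.toLp 2 (Xt, Yt)) := by
      intro k
      rw [dist_eq_norm]
      have h3 := WithLp.norm_fst_le _ (WithLp.toLp 2 (X k, Y k) - WithLp.toLp 2 (Xt, Yt))
      have h4 := WithLp.norm_snd_le _ (WithLp.toLp 2 (X k, Y k) - WithLp.toLp 2 (Xt, Yt))
      simp only [WithLp.sub_fst, WithLp.sub_snd, WithLp.toLp_fst, WithLp.toLp_snd] at h3 h4
      linarith
    refine ⟨fun hθ => ?_, fun hθ => ?_⟩
    · obtain ⟨d, ϱ, hd, hϱ0, hϱ1, h⟩ := h1 hθ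
      refine ⟨2 * d, ϱ, by positivity, hϱ0, hϱ1, h.mono fun k hk => (hle k).trans ?_⟩
      linarith
    · obtain ⟨d, hd, h⟩ := h2 hθ
      refine ⟨2 * d, by positivity, h.mono fun k hk => (hle k).trans ?_⟩
      linarith
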